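/- Fix finite sets $\mathcal V$ (Boolean state variables), $Ch$ (channels), $D$ (Boolean data variables), $K$ (agent identities) and $CV$ (Boolean common variables). An observation is a tuple $m=\langle ch,\mathbf d,k,\pi\rangle$ with $ch\in Ch$, $\mathbf d\in 2^{D}$, $k\in K$ and $\pi\subseteq 2^{CV}$; a system computation is a map $\rho$ from $\mathbb N$ to pairs of a state in $2^{\mathcal V}$ and an observation. Observation descriptors and LTOL formulas are $$O ::= cv\mid\neg cv\mid ch\mid\neg ch\mid k\mid\neg k\mid d\mid\neg d\mid \bullet^{\exists}O\mid\bullet^{\forall}O\mid O\vee O\mid O\wedge O,$$ $$\varphi ::= v\mid\neg v\mid\varphi\vee\varphi\mid\varphi\wedge\varphi\mid\varphi\,\mathcal U\varphi\mid\varphi\,\mathcal R\varphi\mid\langle O\rangle\varphi\mid[O]\varphi .$$ Here $m\models cv$ iff every $c\in\pi$ satisfies $cv$, and $m\models\neg cv$ iff some $c\in\pi$ does not; $m\models\bullet^{\exists}O$ (resp. $\bullet^{\forall}O$) iff $\langle ch,\mathbf d,k,\{c\}\rangle\models O$ for some (resp. every) $c\in\pi$; the other descriptors have the obvious meaning. State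 literals, Boolean connectives, until and release are interpreted over the suffixes $\rho_{\ge i}$ as in LTL; $\rho_{\ge i}\models\langle O\rangle\varphi$ iff $m_i\models O$ and $\rho_{\ge i+1}\models\varphi$; $\rho_{\ge i}\models[O]\varphi$ iff $m_i\models O$ implies $\rho_{\ge i+1}\models\varphi$. Let $|\varphi|$ be the number of symbols of $\varphi$ (descriptors included, each literal being one symbol), let $\mathrm{obs}(\varphi)$ be the set of descriptors $O$ that occur in $\varphi$ as the argument of an operator $\langle O\rangle$ or $[O]$, and let $\Sigma=2^{\mathcal V}$, $\mathcal O=2^{\mathrm{obs}(\varphi)}$. For a word $w=(\sigma_0,o_0)(\sigma_1,o_1)\cdots\in(\Sigma\times\mathcal O)^\omega$ let $L(w)$ be the set of the computations $\rho$ whose state at every time $i$ is $\sigma_i$ and whose observation $m_i$ satisfies exactly those $O\in\mathrm{obs}(\varphi)$ that belong to $o_i$. There is a constant $C$, independent of the fixed sets, such that for every LTOL formula $\varphi$ there is a nondeterministic Büchi word automaton $N_\varphi=\langle Q,\Sigma,\mathcal O,S^0,\delta,F\rangle$ over the alphabet $\Sigma\times\mathcal O$ for which $\bigcup_{w\in L(N_\varphi)}L(w)$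 is exactly the set of the computations that satisfy $\varphi$ (at time $0$), and: - $|Q|\le 2^{C|\varphi|}$; the number $|\delta|$ of transitions satisfies $|\delta|\le|Q|^2\cdot|\Sigma|\cdot|\mathcal O|$ and $|\delta|\le 2^{|\mathcal V|}\cdot2^{C|\varphi|}$ (hence $|\delta|$ is in $2^{O(|\varphi|)}$ when $\mathcal V$ is fixed, and uniformly so when $|\mathcal V|\le|\varphi|$); - $N_\varphi$ can be built in space $O(|\varphi|)$: for the fixed sets there is one deterministic Turing machine with a write-only output that, for every $\varphi$, started on $\varphi$ written in prefix notation with one symbol per cell, halts with a complete list of the states (with names, and marks for initial and accepting ones) and of the transitions of $N_\varphi$ as its output, and visits at most $C|\varphi|$ tape cells, those of the input included and the output not counted; - the size $|Q|\cdot|\delta|$ of $N_\varphi$ is at most $2^{|\mathcal V|}\cdot2^{C|\varphi|}$ (hence in $2^{O(|\varphi|)}$ in the same sense). -/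

import Mathlib

namespace LTOL

/-! ## Observations and observation descriptors

`V`, `Ch`, `D`, `K`, `CV` are the sets of (Boolean) state variables, channels, (Boolean) data
variables, agent identities and (Boolean) common variables. -/

/-- An observation `⟨ch, d, k, π⟩`: a channel, an assignment to the data variables, a sender, and a
predicate over the common variables, given as a set of assignments. -/
structure Observation (Ch D K CV : Type) where
  ch : Ch
  data : D → Bool
  sender : K
  pred : Set (CV → Bool)

/-- Observation descriptors, in positive normal form. -/
inductive Descriptor (Ch D K CV : Type) : Type
  | cv (x : CV)
  | ncv (x : CV)
  | ch (a : Ch)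
  | nch (a : Ch)
  | agent (k : K)
  | nagent (k : K)
  | data (d : D)
  | ndata (d : D)
  | ex (O : Descriptor Ch D K CV)
  | all (O : Descriptor Ch D K CV)
  | or (O₁ O₂ : Descriptor Ch D K CV)
  | and (O₁ O₂ : Descriptor Ch D K CV)

/-- `O.Sat m` is `m ⊨ O`. -/
def Descriptor.Sat {Ch D K CV : Type} : Descriptor Ch D K CV → Observation Ch D K CV → Prop
  | .cv x, m => ∀ c ∈ m.pred, c x = true
  | .ncv x, m => ∃ c ∈ m.pred, ¬ c x = true
  | .ch a, m => m.ch = a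
  | .nch a, m => m.ch ≠ a
  | .agent k, m => m.sender = k
  | .nagent k, m => m.sender ≠ k
  | .data d, m => m.data d = true
  | .ndata d, m => ¬ m.data d = true
  | .ex O, m => ∃ c ∈ m.pred, O.Sat { m with pred := {c} }
  | .all O, m => ∀ c ∈ m.pred, O.Sat { m with pred := {c} }
  | .or O₁ O₂, m => O₁.Sat m ∨ O₂.Sat m
  | .and O₁ O₂, m => O₁.Sat m ∧ O₂.Sat m

/-! ## Formulas -/

/-- LTOL formulas, in positive normal form. -/
inductive Formula (V Ch D K CV : Type) : Type
  | var (v : V)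
  | nvar (v : V)
  | or (φ ψ : Formula V Ch D K CV)
  | and (φ ψ : Formula V Ch D K CV)
  | until (φ ψ : Formula V Ch D K CV)
  | release (φ ψ : Formula V Ch D K CV)
  /-- possible: `⟨O⟩ φ` -/
  | possible (O : Descriptor Ch D K CV) (φ : Formula V Ch D K CV)
  /-- necessary: `[O] φ` -/
  | necessary (O : Descriptor Ch D K CV) (φ : Formula V Ch D K CV)

/-- A system computation: at every time point a system state (an assignment to the state variables)
and an observation. -/
abbrev Computation (V Ch D K CV : Type) : Type :=
  ℕ → (V → Bool) × Observation Ch D K CV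

/-- `φ.SatAt ρ i` is `ρ_{≥ i} ⊨ φ`. -/
def Formula.SatAt {V Ch D K CV : Type} :
    Formula V Ch D K CV → Computation V Ch D K CV → ℕ → Prop
  | .var v, ρ, i => (ρ i).1 v = true
  | .nvar v, ρ, i => ¬ (ρ i).1 v = true
  | .or φ ψ, ρ, i => φ.SatAt ρ i ∨ ψ.SatAt ρ i
  | .and φ ψ, ρ, i => φ.SatAt ρ i ∧ ψ.SatAt ρ i
  | .until φ ψ, ρ, i => ∃ j, i ≤ j ∧ ψ.SatAt ρ j ∧ ∀ k, i ≤ k → k < j → φ.SatAt ρ k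
  | .release φ ψ, ρ, i => ∀ j, i ≤ j → ψ.SatAt ρ j ∨ ∃ k, i ≤ k ∧ k < j ∧ φ.SatAt ρ k
  | .possible O φ, ρ, i => O.Sat (ρ i).2 ∧ φ.SatAt ρ (i + 1)
  | .necessary O φ, ρ, i => O.Sat (ρ i).2 → φ.SatAt ρ (i + 1)

/-! ## Formulas as words, size -/

/-- The symbols from which formulas and descriptors are written. -/
inductive Token (V Ch D K CV : Type) : Type
  | cv (x : CV)
  | ncv (x : CV)
  | ch (a : Ch)
  | nch (a : Ch)
  | agent (k : K)
  | nagent (k : K)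
  | data (d : D)
  | ndata (d : D)
  | ex
  | all
  | descOr
  | descAnd
  | var (v : V)
  | nvar (v : V)
  | or
  | and
  | until
  | release
  | possible
  | necessary
  deriving Fintype

/-- A descriptor in prefix (Polish) notation. -/
def Descriptor.word {V Ch D K CV : Type} : Descriptor Ch D K CV → List (Token V Ch D K CV)
  | .cv x => [.cv x]
  | .ncv x => [.ncv x]
  | .ch a => [.ch a]
  | .nch a => [.nch a]
  | .agent k => [.agent k]
  | .nagent k => [.nagent k]
  | .data d => [.data d]
  | .ndata d => [.ndata d]
  | .ex O => .ex :: O.word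
  | .all O => .all :: O.word
  | .or O₁ O₂ => .descOr :: (O₁.word ++ O₂.word)
  | .and O₁ O₂ => .descAnd :: (O₁.word ++ O₂.word)

/-- A formula in prefix (Polish) notation. -/
def Formula.word {V Ch D K CV : Type} : Formula V Ch D K CV → List (Token V Ch D K CV)
  | .var v => [.var v]
  | .nvar v => [.nvar v]
  | .or φ ψ => .or :: (φ.word ++ ψ.word)
  | .and φ ψ => .and :: (φ.word ++ ψ.word)
  | .until φ ψ => .until :: (φ.word ++ ψ.word)
  | .release φ ψ => .release :: (φ.word ++ ψ.word)
  | .possible O φ => .possible :: (O.word ++ φ.word)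
  | .necessary O φ => .necessary :: (O.word ++ φ.word)

/-- The size `|φ|`: the number of symbols of `φ`, those of its descriptors included. -/
def Formula.size {V Ch D K CV : Type} (φ : Formula V Ch D K CV) : ℕ := φ.word.length

/-! ## The observation alphabet and words -/

/-- The top-level descriptors of `φ` (the arguments of its operators `⟨·⟩` and `[·]`), listed by
occurrence from left to right. -/
def Formula.descriptors {V Ch D K CV : Type} :
    Formula V Ch D K CV → List (Descriptor Ch D K CV)
  | .var _ => []
  | .nvar _ => []
  | .or φ ψ => φ.descriptors ++ ψ.descriptors
  | .and φ ψ => φ.descriptors ++ ψ.descriptors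
  | .until φ ψ => φ.descriptors ++ ψ.descriptors
  | .release φ ψ => φ.descriptors ++ ψ.descriptors
  | .possible O φ => O :: φ.descriptors
  | .necessary O φ => O :: φ.descriptors

/-- The set `obs(φ)` of the top-level descriptors of `φ`, as a type. -/
abbrev Formula.Obs {V Ch D K CV : Type} (φ : Formula V Ch D K CV) : Type :=
  {O : Descriptor Ch D K CV // O ∈ φ.descriptors}

/-- Letters: pairs from the state alphabet `2^V` and the observation alphabet `2^obs(φ)`. -/
abbrev Formula.Letter {V Ch D K CV : Type} (φ : Formula V Ch D K CV) : Type :=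
  (V → Bool) × Set φ.Obs

/-- `L(w)`: the set of the computations satisfying the word `w`. -/
def Formula.wordLang {V Ch D K CV : Type} (φ : Formula V Ch D K CV) (w : ℕ → φ.Letter) :
    Set (Computation V Ch D K CV) :=
  {ρ | ∀ i, (ρ i).1 = (w i).1 ∧ ∀ O : φ.Obs, O.1.Sat (ρ i).2 ↔ O ∈ (w i).2}

/-! ## Nondeterministic Büchi word automata -/

/-- A nondeterministic Büchi word automaton over the alphabet `A`. -/
structure NBW (A : Type) where
  Q : Type
  finite_Q : Finite Q
  init : Set Q
  δ : Q → A → Set Q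
  F : Set Q

/-- `r` is an accepting run on `w`: some state of `F` appears in it infinitely often. -/
def NBW.IsAcceptingRun {A : Type} (N : NBW A) (w : ℕ → A) (r : ℕ → N.Q) : Prop :=
  r 0 ∈ N.init ∧ (∀ i, r (i + 1) ∈ N.δ (r i) (w i)) ∧
    ∃ q ∈ N.F, ∃ᶠ i in Filter.atTop, r i = q

/-- The language of an automaton. -/
def NBW.lang {A : Type} (N : NBW A) : Set (ℕ → A) :=
  {w | ∃ r, N.IsAcceptingRun w r}

/-- The transitions of an automaton, as a set of triples. -/
def NBW.transitions {A : Type} (N : NBW A) : Set (N.Q × A × N.Q) :=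
  {t | t.2.2 ∈ N.δ t.1 t.2.1}

/-- `|Q|`. -/
noncomputable def NBW.numStates {A : Type} (N : NBW A) : ℕ := Nat.card N.Q

/-- `|δ|`: the number of transitions. -/
noncomputable def NBW.numTransitions {A : Type} (N : NBW A) : ℕ := Nat.card N.transitions

/-- The size `|Q| · |δ|` of an automaton. -/
noncomputable def NBW.size {A : Type} (N : NBW A) : ℕ := N.numStates * N.numTransitions

/-! ## Written descriptions of automata -/

/-- The symbols from which descriptions of automata are written. -/
inductive OutSym (V : Type) : Type
  | state
  | trans
  | bit (b : Bool)
  | letter (σ : V → Bool)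
  | arrow

open Classical in
/-- The record of a state: two bits telling whether it is initial and whether it is accepting, and
then its name. -/
noncomputable def stateRecord {V Ch D K CV : Type} {φ : Formula V Ch D K CV} (N : NBW φ.Letter)
    (name : N.Q → List Bool) (q : N.Q) : List (OutSym V) :=
  .state :: .bit (decide (q ∈ N.init)) :: .bit (decide (q ∈ N.F)) :: (name q).map .bit

open Classical in
/-- The record of a transition `(q, (σ, o), q')`: the name of `q`, then `σ`, then `o`, written as
the list of the bits `O ∈ o` where `O` runs through the occurrences of top-level descriptors in `φ`,
then the name of `q'`. -/
noncomputable def transRecord {V Ch D K CV : Type} {φ : Formula V Ch D K CV} (N : NBW φ.Letter)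
    (name : N.Q → List Bool) (t : N.Q × φ.Letter × N.Q) : List (OutSym V) :=
  .trans :: ((name t.1).map .bit ++ .letter t.2.1.1 ::
    (φ.descriptors.attach.map (fun O => .bit (decide (O ∈ t.2.1.2))) ++
      .arrow :: (name t.2.2).map .bit))

/-- `out` is a description of `N`: for some naming of the states by distinct bit strings, it is a
list of the records of all states, each once, followed by the records of all transitions, each
once. -/
def IsDescription {V Ch D K CV : Type} {φ : Formula V Ch D K CV} (N : NBW φ.Letter)
    (out : List (OutSym V)) : Prop :=
  ∃ (name : N.Q → List Bool) (qs : List N.Q) (ts : List (N.Q × φ.Letter × N.Q)),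
    Function.Injective name ∧
    qs.Nodup ∧ (∀ q, q ∈ qs) ∧
    ts.Nodup ∧ (∀ t, t ∈ ts ↔ t ∈ N.transitions) ∧
    out = qs.flatMap (stateRecord N name) ++ ts.flatMap (transRecord N name)

/-! ## Turing machines with a write-only output -/

/-- The movements of a head. -/
inductive Move : Type
  | left
  | stay
  | right

/-- The cell reached by a movement on a tape that is infinite to the right only; a movement to the
left has no effect in the leftmost cell. -/
def Move.apply : Move → ℕ → ℕ
  | .left, n => n - 1
  | .stay, n => n
  | .right, n => n + 1

/-- A deterministic Turing machine with tapes `0, …, k`, finitely many states and a finite tape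
alphabet: a cell is blank or holds an input symbol from `I` or a symbol from `Γ`. In a step, which
depends on the state and on the scanned symbols only, it writes into the scanned cells, moves the
heads, and appends some symbols from `X` to the output, which it never reads; or it halts. -/
structure Machine (I X : Type) [Finite I] where
  k : ℕ
  Γ : Type
  finite_Γ : Finite Γ
  S : Type
  finite_S : Finite S
  start : S
  step : S → (Fin (k + 1) → Option (I ⊕ Γ)) →
    Option (S × (Fin (k + 1) → Option (I ⊕ Γ) × Move) × List X)

/-- A configuration of a machine. -/
structure Machine.Config {I X : Type} [Finite I] (M : Machine I X) where
  state : M.S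
  tape : Fin (M.k + 1) → ℕ → Option (I ⊕ M.Γ)
  head : Fin (M.k + 1) → ℕ
  out : List X

/-- The initial configuration: the input is at the left end of tape `0`, all other cells are blank,
and every head is in the leftmost cell. -/
def Machine.initial {I X : Type} [Finite I] (M : Machine I X) (w : List I) : M.Config where
  state := M.start
  tape := fun i n => if i = 0 then w[n]?.map Sum.inl else none
  head := fun _ => 0
  out := []

/-- The next configuration, if the machine does not halt. -/
def Machine.next {I X : Type} [Finite I] (M : Machine I X) (c : M.Config) : Option M.Config :=
  (M.step c.state (fun i => c.tape i (c.head i))).map fun a =>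
    { state := a.1
      tape := fun i => Function.update (c.tape i) (c.head i) (a.2.1 i).1
      head := fun i => (a.2.1 i).2.apply (c.head i)
      out := c.out ++ a.2.2 }

/-- On input `w`, the machine halts with output `out`. -/
def Machine.HaltsWith {I X : Type} [Finite I] (M : Machine I X) (w : List I) (out : List X) :
    Prop :=
  ∃ c, StateTransition.Reaches M.next (M.initial w) c ∧ M.next c = none ∧ c.out = out

/-- On input `w`, the machine uses at most `s` tape cells: the numbers of cells that are visited on
its tapes (that of the input included, the output excluded) sum up to at most `s`. -/
def Machine.UsesSpace {I X : Type} [Finite I] (M : Machine I X) (w : List I) (s : ℕ) : Prop :=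
  ∃ b : Fin (M.k + 1) → ℕ, ∑ i, b i ≤ s ∧
    ∀ c, StateTransition.Reaches M.next (M.initial w) c → ∀ i, c.head i < b i

end LTOL

/-!
A state of the automaton marks every position of the word `φ` with two bits: whether the subformula
that starts there is due to hold now, and whether, at some time since the last breakpoint, it was
not an until with a pending obligation. A breakpoint is a time at which all second bits are set;
accepting at the breakpoints forces every until to be fulfilled. The transition relation is a
conjunction of conditions on a position, its two arguments and the letter, so that it can be checked
by evaluating `φ`, decorated with the bits of both states, as a term over a finite set.

A Turing machine evaluates a word in prefix notation from right to left with a stack, and hence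
needs no addresses: it holds the decorated word on one tape and the stack on the other, and on the
way back it writes the output and increments the decoration like a counter. To write every letter
of the alphabet `2^obs(φ)` once, it runs through all observations and uses an observation only if
it represents its class modulo the descriptors of `φ`.
-/

namespace LTOL

/-! ## Fixpoints and breakpoints -/

section Temporal

/-- Strong until for properties of time. -/
def Until (a b : ℕ → Prop) (i : ℕ) : Prop :=
  ∃ j, i ≤ j ∧ b j ∧ ∀ k, i ≤ k → k < j → a k

/-- Release for properties of time, the dual of `Until`. -/
def Release (a b : ℕ → Prop) (i : ℕ) : Prop :=
  ∀ j, i ≤ j → b j ∨ ∃ k, i ≤ k ∧ k < j ∧ a k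

variable {a b x : ℕ → Prop} {i : ℕ}

theorem until_iff : Until a b i ↔ b i ∨ a i ∧ Until a b (i + 1) := by
  constructor
  · rintro ⟨j, hij, hb, ha⟩
    rcases hij.eq_or_lt with rfl | hij
    · exact .inl hb
    · exact .inr ⟨ha i le_rfl hij, j, hij, hb, fun k hk => ha k (by omega)⟩
  · rintro (hb | ⟨hai, j, hij, hb, ha⟩)
    · exact ⟨i, le_rfl, hb, fun k _ _ => by omega⟩
    · refine ⟨j, by omega, hb, fun k hik hkj => ?_⟩
      rcases hik.eq_or_lt with rfl | hik
      exacts [hai, ha k hik hkj]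

theorem release_iff_not_until : Release a b i ↔ ¬ Until (fun k => ¬ a k) (fun k => ¬ b k) i := by
  simp only [Release, Until, not_exists, not_and, not_forall, not_not, exists_prop,
    or_iff_not_imp_left]

theorem release_iff : Release a b i ↔ b i ∧ (a i ∨ Release a b (i + 1)) := by
  rw [release_iff_not_until, release_iff_not_until, until_iff]
  tauto

theorem until_of_step (hx : ∀ i, x i → b i ∨ a i ∧ x (i + 1)) (h : ∃ j, i ≤ j ∧ (x j → b j))
    (hi : x i) : Until a b i := by
  obtain ⟨j, hij, hj⟩ := h
  obtain ⟨n, rfl⟩ := Nat.exists_eq_add_of_le hij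
  clear hij
  induction n generalizing i with
  | zero => exact until_iff.2 (.inl (hj hi))
  | succ n ih =>
    rw [← Nat.succ_add_eq_add_succ] at hj
    exact until_iff.2 ((hx i hi).imp_right fun ⟨ha, hx'⟩ => ⟨ha, ih hx' hj⟩)

theorem release_of_step (hx : ∀ i, x i → b i ∧ (a i ∨ x (i + 1))) (hi : x i) :
    Release a b i := by
  have invariant : ∀ j, i ≤ j → x j ∨ ∃ k, i ≤ k ∧ k < j ∧ a k := by
    intro j hij
    induction j, hij using Nat.le_induction with
    | base => exact .inl hi
    | succ j hij ih =>
      rcases ih with h | ⟨k, hik, hkj, hk⟩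
      · exact (hx j h).2.symm.imp_right fun ha => ⟨j, hij, j.lt_succ_self, ha⟩
      · exact .inr ⟨k, hik, hkj.trans j.lt_succ_self, hk⟩
  exact fun j hij => (invariant j hij).imp_left fun h => (hx j h).1

end Temporal

section Breakpoints
open Filter

theorem frequently_of_breakpoints {done clear acc : ℕ → Prop} (hacc : ∃ᶠ i in atTop, acc i)
    (hclear : ∀ i, acc i → clear i)
    (hstep : ∀ i, clear (i + 1) → done (i + 1) ∨ clear i ∧ ¬ acc i) : ∃ᶠ i in atTop, done i := by
  by_contra h
  obtain ⟨N, hN⟩ := eventually_atTop.1 (not_frequently.1 h)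
  obtain ⟨i, hNi, hi⟩ := frequently_atTop.1 hacc N
  have not_clear : ∀ j, i + 1 ≤ j → ¬ clear j := by
    intro j hij
    induction j, hij using Nat.le_induction with
    | base => exact fun hc => (hstep i hc).elim (hN _ (by omega)) fun h => h.2 hi
    | succ j hij ih => exact fun hc => (hstep j hc).elim (hN _ (by omega)) fun h => ih h.1
  obtain ⟨j, hij, hj⟩ := frequently_atTop.1 hacc (i + 1)
  exact not_clear j hij (hclear j hj)

/-- `ClearSince S done i y`: the item `y` has been done at some time since the last breakpoint
before `i`, a breakpoint being a time when this holds for all items of `S`. -/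
def ClearSince {ι : Type*} (S : Set ι) (done : ℕ → ι → Prop) : ℕ → ι → Prop
  | 0, _ => True
  | i + 1, y => done (i + 1) y ∨ ClearSince S done i y ∧ ¬ ∀ z ∈ S, ClearSince S done i z

theorem frequently_clearSince {ι : Type*} {S : Set ι} (hS : S.Finite) {done : ℕ → ι → Prop}
    (hdone : ∀ y ∈ S, ∃ᶠ i in atTop, done i y) :
    ∃ᶠ i in atTop, ∀ y ∈ S, ClearSince S done i y := by
  by_contra h
  obtain ⟨N, hN⟩ := eventually_atTop.1 (not_frequently.1 h)
  have eventually_clear : ∀ y ∈ S, ∀ᶠ i in atTop, ClearSince S done i y := by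
    intro y hy
    obtain ⟨j, hj, hjy⟩ := frequently_atTop.1 (hdone y hy) (N + 1)
    refine eventually_atTop.2 ⟨j, fun i hji => ?_⟩
    induction i, hji using Nat.le_induction with
    | base =>
      obtain ⟨k, rfl⟩ := Nat.exists_eq_succ_of_ne_zero (show j ≠ 0 by omega)
      exact .inl hjy
    | succ i hji ih => exact .inr ⟨ih, hN i (by omega)⟩
  exact h (((eventually_all_finite hS).2 eventually_clear).frequently)

theorem exists_frequently_eq {Q : Type*} [Finite Q] {F : Set Q} {r : ℕ → Q}
    (h : ∃ᶠ i in atTop, r i ∈ F) : ∃ q ∈ F, ∃ᶠ i in atTop, r i = q := by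
  by_contra! hc
  have never : ∀ᶠ i in atTop, ∀ q ∈ F, r i ≠ q :=
    (eventually_all_finite F.toFinite).2 fun q hq => hc q hq
  exact h (never.mono fun i hi hF => hi _ hF rfl)

end Breakpoints

/-! ## The automaton of a formula -/

section Positions
variable {V Ch D K CV : Type}

-- The cases of `Formula.rec` cannot all be named in `induction`, since `until` is a keyword.
@[elab_as_elim, induction_eliminator]
theorem Formula.structural {P : Formula V Ch D K CV → Prop} (var : ∀ v, P (.var v))
    (nvar : ∀ v, P (.nvar v)) (or : ∀ φ ψ, P φ → P ψ → P (.or φ ψ))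
    (and : ∀ φ ψ, P φ → P ψ → P (.and φ ψ)) (strongUntil : ∀ φ ψ, P φ → P ψ → P (.until φ ψ))
    (release : ∀ φ ψ, P φ → P ψ → P (.release φ ψ))
    (possible : ∀ O φ, P φ → P (.possible O φ)) (necessary : ∀ O φ, P φ → P (.necessary O φ))
    (φ : Formula V Ch D K CV) : P φ :=
  φ.rec var nvar or and strongUntil release possible necessary

/-- The number of symbols of a descriptor. -/
def Descriptor.size : Descriptor Ch D K CV → ℕ
  | .cv _ | .ncv _ | .ch _ | .nch _ | .agent _ | .nagent _ | .data _ | .ndata _ => 1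
  | .ex O | .all O => O.size + 1
  | .or O₁ O₂ | .and O₁ O₂ => O₁.size + O₂.size + 1

@[simp]
theorem Descriptor.length_word (O : Descriptor Ch D K CV) :
    (O.word (V := V)).length = O.size := by
  induction O <;> simp_all [Descriptor.word, Descriptor.size]

theorem Formula.size_pos (φ : Formula V Ch D K CV) : 0 < φ.size := by
  cases φ <;> simp [Formula.size, Formula.word]

/-- `φ.All R p`: when `φ` is written from position `p` on, `R χ k` holds for every subformula `χ`
of `φ` and the position `k` of its first symbol. -/
def Formula.All (R : Formula V Ch D K CV → ℕ → Prop) : Formula V Ch D K CV → ℕ → Prop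
  | .var v, p => R (.var v) p
  | .nvar v, p => R (.nvar v) p
  | .or φ ψ, p => R (.or φ ψ) p ∧ φ.All R (p + 1) ∧ ψ.All R (p + 1 + φ.size)
  | .and φ ψ, p => R (.and φ ψ) p ∧ φ.All R (p + 1) ∧ ψ.All R (p + 1 + φ.size)
  | .until φ ψ, p => R (.until φ ψ) p ∧ φ.All R (p + 1) ∧ ψ.All R (p + 1 + φ.size)
  | .release φ ψ, p => R (.release φ ψ) p ∧ φ.All R (p + 1) ∧ ψ.All R (p + 1 + φ.size)
  | .possible O φ, p => R (.possible O φ) p ∧ φ.All R (p + 1 + O.size)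
  | .necessary O φ, p => R (.necessary O φ) p ∧ φ.All R (p + 1 + O.size)

theorem Formula.All.root {R : Formula V Ch D K CV → ℕ → Prop} {φ : Formula V Ch D K CV} {p : ℕ}
    (h : φ.All R p) : R φ p := by
  cases φ with
  | var | nvar => exact h
  | _ => exact h.1

/-- The subformulas of `φ` by the positions of their first symbols; the positions inside
descriptors hold `none`. -/
def Formula.subs : Formula V Ch D K CV → List (Option (Formula V Ch D K CV))
  | .var v => [some (.var v)]
  | .nvar v => [some (.nvar v)]
  | .or φ ψ => some (.or φ ψ) :: (φ.subs ++ ψ.subs)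
  | .and φ ψ => some (.and φ ψ) :: (φ.subs ++ ψ.subs)
  | .until φ ψ => some (.until φ ψ) :: (φ.subs ++ ψ.subs)
  | .release φ ψ => some (.release φ ψ) :: (φ.subs ++ ψ.subs)
  | .possible O φ => some (.possible O φ) :: (List.replicate O.size none ++ φ.subs)
  | .necessary O φ => some (.necessary O φ) :: (List.replicate O.size none ++ φ.subs)

@[simp]
theorem Formula.length_subs (φ : Formula V Ch D K CV) : φ.subs.length = φ.size := by
  induction φ <;> simp_all [Formula.subs, Formula.size, Formula.word]

theorem Formula.all_of_getElem?_subs {L : ℕ → Option (Formula V Ch D K CV)}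
    {φ : Formula V Ch D K CV} {p : ℕ} (h : ∀ k y, φ.subs[k]? = some y → L (p + k) = y) :
    φ.All (fun χ k => L k = some χ) p := by
  induction φ generalizing p with
  | var v | nvar v => exact h 0 _ rfl
  | or φ ψ ih₁ ih₂ | and φ ψ ih₁ ih₂ | strongUntil φ ψ ih₁ ih₂ | release φ ψ ih₁ ih₂ =>
    refine ⟨h 0 _ rfl, ih₁ fun k y hk => ?_, ih₂ fun k y hk => ?_⟩
    · have := h (k + 1) y
      grind [Formula.subs]
    · have := h (φ.size + k + 1) y
      grind [Formula.subs, Formula.length_subs]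
  | possible O φ ih | necessary O φ ih =>
    refine ⟨h 0 _ rfl, ih fun k y hk => ?_⟩
    have := h (O.size + k + 1) y
    grind [Formula.subs]

end Positions

section Semantics
variable {V Ch D K CV : Type}

/-- The record of an automaton state on one subformula: whether the subformula is due to hold now,
and whether it has been free of pending obligations at some time since the last accepting state. -/
structure Entry where
  due : Bool
  clear : Bool
  deriving Fintype

/-- States of the automaton of a formula with `n` symbols. -/
abbrev State (n : ℕ) : Type := Fin n → Entry

/-- The entry at a position; it is harmless beyond the end. -/
def State.entry {n : ℕ} (q : State n) (p : ℕ) : Entry :=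
  if h : p < n then q ⟨p, h⟩ else ⟨false, true⟩

@[simp]
theorem State.entry_val {n : ℕ} (q : State n) (p : Fin n) : q.entry p = q p := dif_pos p.2

/-- The local transition condition for the subformula at a position, between states with the
entries `q` and `q'`; `acc` tells whether the first of them is accepting. -/
def Formula.LocalStep (a : (V → Bool) × Observation Ch D K CV) (acc : Prop) (q q' : ℕ → Entry) :
    Formula V Ch D K CV → ℕ → Prop
  | .var v, p => (q p).due → a.1 v
  | .nvar v, p => (q p).due → ¬ a.1 v
  | .or φ _, p => (q p).due → (q (p + 1)).due ∨ (q (p + 1 + φ.size)).due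
  | .and φ _, p => (q p).due → (q (p + 1)).due ∧ (q (p + 1 + φ.size)).due
  | .until φ _, p =>
    ((q p).due → (q (p + 1 + φ.size)).due ∨ (q (p + 1)).due ∧ (q' p).due) ∧
      ((q' p).clear →
        ((q' p).due → (q' (p + 1 + φ.size)).due) ∨ (q p).clear ∧ ¬ acc)
  | .release φ _, p => (q p).due → (q (p + 1 + φ.size)).due ∧ ((q (p + 1)).due ∨ (q' p).due)
  | .possible O _, p => (q p).due → O.Sat a.2 ∧ (q' (p + 1 + O.size)).due
  | .necessary O _, p => (q p).due → O.Sat a.2 → (q' (p + 1 + O.size)).due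

theorem Formula.all_localStep_congr {φ : Formula V Ch D K CV} {σ : V → Bool}
    {m m' : Observation Ch D K CV} (h : ∀ O ∈ φ.descriptors, O.Sat m ↔ O.Sat m') {acc : Prop}
    {q q' : ℕ → Entry} {p : ℕ} :
    φ.All (Formula.LocalStep (σ, m) acc q q') p ↔
      φ.All (Formula.LocalStep (σ, m') acc q q') p := by
  induction φ generalizing p with
  | var v | nvar v => rfl
  | or φ ψ ih₁ ih₂ | and φ ψ ih₁ ih₂ | strongUntil φ ψ ih₁ ih₂ | release φ ψ ih₁ ih₂ =>
    rw [Formula.descriptors, List.forall_mem_append] at h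
    exact and_congr Iff.rfl (and_congr (ih₁ h.1) (ih₂ h.2))
  | possible O φ ih | necessary O φ ih =>
    rw [Formula.descriptors, List.forall_mem_cons] at h
    exact and_congr (by simp only [Formula.LocalStep, h.1]) (ih h.2)

variable {ρ : Computation V Ch D K CV}

theorem Formula.satAt_of_localStep {φ : Formula V Ch D K CV} {q : ℕ → ℕ → Entry} {acc : ℕ → Prop}
    (hacc : ∃ᶠ i in Filter.atTop, acc i) (hclear : ∀ i, acc i → ∀ p, (q i p).clear) {p : ℕ}
    (hstep : ∀ i, φ.All (Formula.LocalStep (ρ i) (acc i) (q i) (q (i + 1))) p) {i : ℕ}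
    (hi : (q i p).due) : φ.SatAt ρ i := by
  induction φ generalizing p i with
  | var v | nvar v => exact hstep i hi
  | or φ ψ ih₁ ih₂ =>
    exact ((hstep i).1 hi).imp (ih₁ fun i => (hstep i).2.1) (ih₂ fun i => (hstep i).2.2)
  | and φ ψ ih₁ ih₂ =>
    exact ((hstep i).1 hi).imp (ih₁ fun i => (hstep i).2.1) (ih₂ fun i => (hstep i).2.2)
  | strongUntil φ ψ ih₁ ih₂ =>
    have discharged := frequently_of_breakpoints
      (done := fun i => (q i p).due → (q i (p + 1 + φ.size)).due) hacc
      (fun i h => hclear i h p) fun i => (hstep i).1.2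
    obtain ⟨j, hij, hj⟩ := Filter.frequently_atTop.1 discharged i
    refine until_of_step (x := fun i => (q i p).due) (fun i hi => ?_)
      ⟨j, hij, fun h => ih₂ (fun i => (hstep i).2.2) (hj h)⟩ hi
    exact ((hstep i).1.1 hi).imp (ih₂ fun i => (hstep i).2.2)
      (And.imp_left (ih₁ fun i => (hstep i).2.1))
  | release φ ψ ih₁ ih₂ =>
    refine release_of_step (x := fun i => (q i p).due) (fun i hi => ?_) hi
    exact ((hstep i).1 hi).imp (ih₂ fun i => (hstep i).2.2)
      (Or.imp_left (ih₁ fun i => (hstep i).2.1))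
  | possible O φ ih => exact ((hstep i).1 hi).imp_right (ih fun i => (hstep i).2)
  | necessary O φ ih => exact fun hO => ih (fun i => (hstep i).2) ((hstep i).1 hi hO)

/-- No obligation of `χ` to fulfil an until is pending at time `i`. -/
def Formula.Discharged (ρ : Computation V Ch D K CV) (i : ℕ) : Formula V Ch D K CV → Prop
  | .until φ ψ => (Formula.until φ ψ).SatAt ρ i → ψ.SatAt ρ i
  | _ => True

theorem Formula.frequently_discharged (ρ : Computation V Ch D K CV) (χ : Formula V Ch D K CV) :
    ∃ᶠ i in Filter.atTop, χ.Discharged ρ i := by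
  refine Filter.frequently_atTop.2 fun i => ?_
  induction χ with
  | strongUntil φ ψ =>
    by_cases h : (Formula.until φ ψ).SatAt ρ i
    · obtain ⟨j, hij, hψ, _⟩ := h
      exact ⟨j, hij, fun _ => hψ⟩
    · exact ⟨i, le_rfl, fun h' => absurd h' h⟩
  | _ => exact ⟨i, le_rfl, trivial⟩

open Classical in
/-- The entry for a subformula of `S` in the canonical run on `ρ` at time `i`. -/
noncomputable def mark (ρ : Computation V Ch D K CV) (S : Set (Formula V Ch D K CV)) (i : ℕ) :
    Option (Formula V Ch D K CV) → Entry
  | none => ⟨false, true⟩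
  | some χ => ⟨χ.SatAt ρ i, ClearSince S (fun i χ => χ.Discharged ρ i) i χ⟩

theorem Formula.localStep_mark {S : Set (Formula V Ch D K CV)} {i : ℕ}
    {L : ℕ → Option (Formula V Ch D K CV)} {φ : Formula V Ch D K CV} {p : ℕ}
    (h : φ.All (fun χ k => L k = some χ) p) :
    φ.All (Formula.LocalStep (ρ i) (∀ χ ∈ S, ClearSince S (fun i χ => χ.Discharged ρ i) i χ)
      (fun k => mark ρ S i (L k)) (fun k => mark ρ S (i + 1) (L k))) p := by
  induction φ generalizing p with
  | var v | nvar v =>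
    simp only [Formula.All, Formula.LocalStep, mark, h.root, decide_eq_true_eq]
    exact id
  | or φ ψ ih₁ ih₂ | and φ ψ ih₁ ih₂ | strongUntil φ ψ ih₁ ih₂ | release φ ψ ih₁ ih₂ =>
    refine ⟨?_, ih₁ h.2.1, ih₂ h.2.2⟩
    simp only [Formula.LocalStep, mark, h.1, h.2.1.root, h.2.2.root, decide_eq_true_eq]
    first
    | exact id
    | exact release_iff.1
    | exact ⟨until_iff.1, id⟩
  | possible O φ ih | necessary O φ ih =>
    refine ⟨?_, ih h.2⟩
    simp only [Formula.LocalStep, mark, h.1, h.2.root, decide_eq_true_eq]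
    exact id

end Semantics

section Automaton
variable {V Ch D K CV : Type}

/-- The descriptors of `φ` that an observation satisfies. -/
def Formula.obsSet (φ : Formula V Ch D K CV) (m : Observation Ch D K CV) : Set φ.Obs :=
  {O | O.1.Sat m}

/-- The accepting states: breakpoints, at which every until has been free of pending obligations
since the last breakpoint. -/
def State.Accepting {n : ℕ} (q : State n) : Prop := ∀ p, (q.entry p).clear

theorem State.accepting_iff {n : ℕ} {q : State n} : q.Accepting ↔ ∀ k, (q k).clear := by
  refine ⟨fun h k => q.entry_val k ▸ h k, fun h p => ?_⟩
  unfold State.entry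
  split
  exacts [h _, rfl]

/-- The automaton of a formula, which guesses the subformulas to be fulfilled at each time. -/
def Formula.automaton (φ : Formula V Ch D K CV) : NBW φ.Letter where
  Q := State φ.size
  finite_Q := inferInstance
  init := {q | (q.entry 0).due}
  δ q a := {q' | ∃ m, φ.obsSet m = a.2 ∧
    φ.All (Formula.LocalStep (a.1, m) q.Accepting q.entry q'.entry) 0}
  F := {q | q.Accepting}

theorem Formula.obsSet_eq_iff {φ : Formula V Ch D K CV} {m m' : Observation Ch D K CV} :
    φ.obsSet m = φ.obsSet m' ↔ ∀ O ∈ φ.descriptors, O.Sat m ↔ O.Sat m' :=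
  Set.ext_iff.trans Subtype.forall

theorem Formula.mem_δ_automaton {φ : Formula V Ch D K CV} {q q' : State φ.size} {σ : V → Bool}
    {m : Observation Ch D K CV} :
    q' ∈ φ.automaton.δ q (σ, φ.obsSet m) ↔
      φ.All (Formula.LocalStep (σ, m) q.Accepting q.entry q'.entry) 0 :=
  ⟨fun ⟨_, hm, h⟩ => (Formula.all_localStep_congr (Formula.obsSet_eq_iff.1 hm)).1 h,
    fun h => ⟨m, rfl, h⟩⟩

theorem Formula.satAt_of_isAcceptingRun {φ : Formula V Ch D K CV} {ρ : Computation V Ch D K CV}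
    {w : ℕ → φ.Letter} (hρ : ρ ∈ φ.wordLang w) {r : ℕ → φ.automaton.Q}
    (hr : φ.automaton.IsAcceptingRun w r) : φ.SatAt ρ 0 := by
  obtain ⟨h0, hδ, f, hf, hinf⟩ := hr
  have accepting : ∃ᶠ i in Filter.atTop, (r i).Accepting := hinf.mono fun i hi => hi ▸ hf
  have letter (i : ℕ) : w i = ((ρ i).1, φ.obsSet (ρ i).2) :=
    Prod.ext (hρ i).1.symm (Set.ext fun O => ((hρ i).2 O).symm)
  exact Formula.satAt_of_localStep accepting (fun i h => h)
    (fun i => Formula.mem_δ_automaton.1 (letter i ▸ hδ i)) h0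

theorem Formula.exists_isAcceptingRun {φ : Formula V Ch D K CV} {ρ : Computation V Ch D K CV}
    (h : φ.SatAt ρ 0) :
    ∃ r, φ.automaton.IsAcceptingRun (fun i => ((ρ i).1, φ.obsSet (ρ i).2)) r := by
  let L : ℕ → Option (Formula V Ch D K CV) := fun p => φ.subs.getD p none
  let S : Set (Formula V Ch D K CV) := {χ | some χ ∈ φ.subs}
  let r (i : ℕ) : State φ.size := fun p => mark ρ S i (L p)
  have entry_r (i : ℕ) : (r i).entry = fun p => mark ρ S i (L p) := by
    funext p
    by_cases hp : p < φ.size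
    · simp [State.entry, hp, r]
    · simp [State.entry, hp, L, mark]
  have mem_S {χ : Formula V Ch D K CV} : χ ∈ S ↔ ∃ p, L p = some χ := by
    simp [S, L, List.mem_iff_getElem?, Option.getD_eq_iff]
  have accepting_r (i : ℕ) :
      (r i).Accepting ↔ ∀ χ ∈ S, ClearSince S (fun i χ => χ.Discharged ρ i) i χ := by
    simp only [State.Accepting, entry_r, mem_S, forall_exists_index]
    rw [forall_comm]
    refine forall_congr' fun p => ?_
    cases L p <;> simp [mark]
  have all_L : φ.All (fun χ p => L p = some χ) 0 :=
    Formula.all_of_getElem?_subs fun k y hk => by simp [L, hk]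
  have finite_S : S.Finite :=
    φ.subs.finite_toSet.preimage (Option.some_injective _).injOn
  refine ⟨r, ?_, fun i => ⟨(ρ i).2, rfl, ?_⟩, exists_frequently_eq (Q := State φ.size) ?_⟩
  · change ((r 0).entry 0).due
    simpa only [entry_r, mark, all_L.root, decide_eq_true_eq] using h
  · rw [accepting_r, entry_r, entry_r]
    exact Formula.localStep_mark all_L
  · exact (frequently_clearSince finite_S fun χ _ => χ.frequently_discharged ρ).mono
      fun i hi => (accepting_r i).2 hi

theorem Formula.iUnion_wordLang_automaton (φ : Formula V Ch D K CV) :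
    (⋃ w ∈ φ.automaton.lang, φ.wordLang w) = {ρ | φ.SatAt ρ 0} := by
  ext ρ
  simp only [Set.mem_iUnion, exists_prop]
  refine ⟨fun ⟨w, ⟨r, hr⟩, hρ⟩ => Formula.satAt_of_isAcceptingRun hρ hr, fun h => ?_⟩
  exact ⟨_, Formula.exists_isAcceptingRun h, fun i => ⟨rfl, fun O => Iff.rfl⟩⟩

theorem Formula.numStates_automaton (φ : Formula V Ch D K CV) :
    φ.automaton.numStates = 2 ^ (2 * φ.size) := by
  have card_entry : Fintype.card Entry = 2 ^ 2 := rfl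
  change Nat.card (State φ.size) = _
  rw [Nat.card_eq_fintype_card, Fintype.card_fun, card_entry, Fintype.card_fin, pow_mul]

theorem Formula.length_descriptors_le (φ : Formula V Ch D K CV) :
    φ.descriptors.length ≤ φ.size := by
  induction φ <;> simp_all [Formula.descriptors, Formula.size, Formula.word] <;> omega

instance (φ : Formula V Ch D K CV) : Finite φ.Obs := List.finite_toSet φ.descriptors

theorem Formula.card_obs_le (φ : Formula V Ch D K CV) : Nat.card φ.Obs ≤ φ.size := by
  classical
  refine le_trans ?_ φ.length_descriptors_le
  rw [Nat.card_congr (Equiv.subtypeEquivRight fun O => List.mem_toFinset.symm),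
    Nat.card_eq_fintype_card, Fintype.card_coe]
  exact φ.descriptors.toFinset_card_le

theorem Formula.card_set_obs_le (φ : Formula V Ch D K CV) :
    Nat.card (Set φ.Obs) ≤ 2 ^ φ.size := by
  have := Fintype.ofFinite φ.Obs
  rw [Nat.card_eq_fintype_card, Fintype.card_set, ← Nat.card_eq_fintype_card]
  exact Nat.pow_le_pow_right two_pos φ.card_obs_le

theorem NBW.numTransitions_le {A B : Type} [Finite A] [Finite B] (N : NBW (A × B)) :
    N.numTransitions ≤ N.numStates ^ 2 * Nat.card A * Nat.card B := by
  have := N.finite_Q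
  calc N.numTransitions ≤ Nat.card (N.Q × (A × B) × N.Q) :=
        Nat.card_le_card_of_injective _ Subtype.val_injective
    _ = N.numStates ^ 2 * Nat.card A * Nat.card B := by
        simp only [Nat.card_prod, NBW.numStates]; ring

theorem Formula.numTransitions_automaton_le [Fintype V] (φ : Formula V Ch D K CV) :
    φ.automaton.numTransitions ≤ 2 ^ Fintype.card V * 2 ^ (5 * φ.size) := by
  calc φ.automaton.numTransitions
      ≤ φ.automaton.numStates ^ 2 * Nat.card (V → Bool) * Nat.card (Set φ.Obs) :=
        φ.automaton.numTransitions_le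
    _ ≤ (2 ^ (2 * φ.size)) ^ 2 * 2 ^ Fintype.card V * 2 ^ φ.size := by
        gcongr
        · exact φ.numStates_automaton.le
        · rw [Nat.card_fun, Nat.card_eq_fintype_card, Fintype.card_bool, Nat.card_eq_fintype_card]
        · exact φ.card_set_obs_le
    _ = 2 ^ Fintype.card V * 2 ^ (5 * φ.size) := by ring

theorem Formula.size_automaton_le [Fintype V] (φ : Formula V Ch D K CV) :
    φ.automaton.size ≤ 2 ^ Fintype.card V * 2 ^ (7 * φ.size) := by
  calc φ.automaton.size
      ≤ 2 ^ (2 * φ.size) * (2 ^ Fintype.card V * 2 ^ (5 * φ.size)) :=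
        Nat.mul_le_mul φ.numStates_automaton.le φ.numTransitions_automaton_le
    _ = 2 ^ Fintype.card V * 2 ^ (7 * φ.size) := by ring

end Automaton

/-! ## Nested loops -/

section Enumeration
variable {α β : Type*}

/-- `Enumerates f a l`: iterating the partial function `f` from `a` passes through the elements
of `l` and then stops. -/
inductive Enumerates (f : α → Option α) : α → List α → Prop
  | last {a : α} : f a = none → Enumerates f a [a]
  | step {a b : α} {l : List α} : f a = some b → Enumerates f b l → Enumerates f a (a :: l)

/-- `IsListing l`: the list `l` contains every element of its type exactly once. -/
def IsListing (l : List α) : Prop := l.Nodup ∧ ∀ a, a ∈ l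

theorem IsListing.product {l : List α} {m : List β} (hl : IsListing l) (hm : IsListing m) :
    IsListing (l ×ˢ m) :=
  ⟨hl.1.product hm.1, fun x => List.mem_product.2 ⟨hl.2 x.1, hm.2 x.2⟩⟩

theorem IsListing.map {l : List α} (hl : IsListing l) {h : α → β} (hh : h.Bijective) :
    IsListing (l.map h) :=
  ⟨hl.1.map hh.1, fun b => (hh.2 b).elim fun a ha => ha ▸ List.mem_map_of_mem (hl.2 a)⟩

theorem flatMap_product {γ : Type*} (l : List α) (m : List β) (F : α × β → List γ) :
    (l ×ˢ m).flatMap F = l.flatMap fun a => m.flatMap fun b => F (a, b) := by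
  simp only [SProd.sprod, List.product, List.flatMap_assoc, List.flatMap_map]

theorem IsListing.exists_flatMap_ite {γ : Type*} {l : List α} (hl : IsListing l) {S : Set α}
    [DecidablePred (· ∈ S)] {T : Set β} {f : α → β} (hf : S.BijOn f T) (F : β → List γ) :
    ∃ m : List β, m.Nodup ∧ (∀ b, b ∈ m ↔ b ∈ T) ∧
      l.flatMap (fun a => if a ∈ S then F (f a) else []) = m.flatMap F := by
  refine ⟨(l.filter (· ∈ S)).map f, (hl.1.filter _).map_on fun a ha b hb => ?_, fun b => ?_, ?_⟩
  · exact hf.injOn (by simpa using List.of_mem_filter ha) (by simpa using List.of_mem_filter hb)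
  · simp [hl.2, ← hf.image_eq]
  · rw [List.flatMap_map]
    clear hl
    induction l with
    | nil => rfl
    | cons a l ih => by_cases ha : a ∈ S <;> simp [ha, ih]

theorem Enumerates.congr {f g : α → Option α} {a : α} {l : List α} (hl : Enumerates f a l)
    (hfg : ∀ b ∈ l, g b = f b) : Enumerates g a l := by
  induction hl with
  | last ha => exact .last ((hfg _ (by simp)).trans ha)
  | step ha _ ih =>
    exact .step ((hfg _ (by simp)).trans ha) (ih fun b hb => hfg b (List.mem_cons_of_mem _ hb))

theorem Enumerates.map {f : α → Option α} {g : β → Option β} {h : α → β}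
    (hg : ∀ a, g (h a) = (f a).map h) {a : α} {l : List α} (hl : Enumerates f a l) :
    Enumerates g (h a) (l.map h) := by
  induction hl with
  | last ha => exact .last (by rw [hg, ha, Option.map_none])
  | step ha _ ih => exact .step (by rw [hg, ha, Option.map_some]) ih

theorem exists_enumerates_cons {a : α} {l : List α} (h : (a :: l).Nodup) :
    ∃ f, Enumerates f a (a :: l) := by
  classical
  induction l generalizing a with
  | nil => exact ⟨fun _ => none, .last rfl⟩
  | cons b l ih =>
    rw [List.nodup_cons] at h
    obtain ⟨f, hf⟩ := ih h.2
    refine ⟨Function.update f a (some b), .step (Function.update_self ..) (hf.congr fun c hc => ?_)⟩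
    exact Function.update_of_ne (ne_of_mem_of_not_mem hc h.1) ..

theorem exists_isListing (α : Type*) [Finite α] : ∃ l : List α, IsListing l :=
  have := Fintype.ofFinite α
  ⟨Finset.univ.toList, Finset.nodup_toList _, fun a => Finset.mem_toList.2 (Finset.mem_univ a)⟩

theorem exists_enumerates (α : Type*) [Finite α] [Nonempty α] :
    ∃ (f : α → Option α) (a : α) (l : List α), Enumerates f a l ∧ IsListing l := by
  obtain ⟨l, hl⟩ := exists_isListing α
  cases l with
  | nil => exact absurd (hl.2 (Classical.arbitrary α)) List.not_mem_nil
  | cons a l => exact (exists_enumerates_cons hl.1).imp fun f hf => ⟨a, a :: l, hf, hl⟩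

theorem exists_enumerates_option (α : Type*) [Finite α] :
    ∃ (f : Option α → Option (Option α)) (l : List α),
      Enumerates f none (none :: l.map some) ∧ IsListing l := by
  obtain ⟨l, hl⟩ := exists_isListing α
  obtain ⟨f, hf⟩ := exists_enumerates_cons (a := none) (l := l.map some)
    (List.nodup_cons.2 ⟨by simp, hl.1.map (Option.some_injective α)⟩)
  exact ⟨f, l, hf, hl⟩

/-- The successor function of a nested loop, whose inner loop starts from `b₀`. -/
def succProd (f : α → Option α) (b₀ : β) (g : β → Option β) (x : α × β) : Option (α × β) :=
  match g x.2 with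
  | some b => some (x.1, b)
  | none => (f x.1).map (·, b₀)

theorem Enumerates.prod {f : α → Option α} {b₀ : β} {g : β → Option β} {a : α} {l : List α}
    {m : List β} (hl : Enumerates f a l) (hm : Enumerates g b₀ m) :
    Enumerates (succProd f b₀ g) (a, b₀) (l ×ˢ m) := by
  have last_row {a : α} (ha : f a = none) {b : β} {m : List β} (hm : Enumerates g b m) :
      Enumerates (succProd f b₀ g) (a, b) (m.map (Prod.mk a)) := by
    induction hm with
    | last hb => exact .last (by simp [succProd, hb, ha])
    | step hb _ ih => exact .step (by simp [succProd, hb]) ih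
  have inner_row {a a' : α} (ha : f a = some a') {l : List (α × β)}
      (hl : Enumerates (succProd f b₀ g) (a', b₀) l) {b : β} {m : List β}
      (hm : Enumerates g b m) :
      Enumerates (succProd f b₀ g) (a, b) (m.map (Prod.mk a) ++ l) := by
    induction hm with
    | last hb => exact .step (by simp [succProd, hb, ha]) hl
    | step hb _ ih => exact .step (by simp [succProd, hb]) ih
  induction hl with
  | last ha => simpa [List.product_cons] using last_row ha hm
  | step ha _ ih => simpa only [List.product_cons] using inner_row ha ih hm

/-- The successor function on words of digits in little-endian order. -/
def succWord (succ : α → Option α) (zero : α) : List α → Option (List α)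
  | [] => none
  | e :: es =>
    match succ e with
    | some e' => some (e' :: es)
    | none => (succWord succ zero es).map (zero :: ·)

theorem Enumerates.words {succ : α → Option α} {zero : α} {l : List α}
    (hl : Enumerates succ zero l) (hl' : IsListing l) (n : ℕ) :
    ∃ ws : List (Fin n → α), IsListing ws ∧
      Enumerates (succWord succ zero) (List.replicate n zero) (ws.map List.ofFn) := by
  induction n with
  | zero =>
    exact ⟨[Fin.elim0], ⟨List.nodup_singleton _, fun v => by simp [Subsingleton.elim v Fin.elim0]⟩,
      .last rfl⟩
  | succ n ih =>
    obtain ⟨ws, hws, henum⟩ := ih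
    refine ⟨(ws ×ˢ l).map fun x => Fin.cons x.2 x.1, (hws.product hl').map ?_, ?_⟩
    · refine ⟨fun x y h => ?_, fun v => ⟨(Fin.tail v, v 0), Fin.cons_self_tail v⟩⟩
      exact Prod.ext (Fin.cons_injective2 h).2 (Fin.cons_injective2 h).1
    · have semiconj (x : List α × α) : succWord succ zero (x.2 :: x.1) =
          (succProd (succWord succ zero) zero succ x).map fun x => x.2 :: x.1 := by
        simp only [succWord, succProd]
        cases succ x.2 <;> simp [Function.comp_def]
      simpa [SProd.sprod, List.product, List.map_flatMap, List.flatMap_map, Function.comp_def,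
        List.replicate_succ] using (henum.prod hl).map semiconj

end Enumeration

/-! ## Evaluating words in prefix notation on a Turing machine -/

theorem Machine.UsesSpace.mono {I X : Type} [Finite I] {M : Machine I X} {w : List I} {s t : ℕ}
    (h : M.UsesSpace w s) (hst : s ≤ t) : M.UsesSpace w t :=
  h.imp fun _ hb => ⟨hb.1.trans hst, hb.2⟩

section Runs
variable {I X : Type} [Finite I] {M : Machine I X} {P : M.Config → Prop} {a c d : M.Config}

/-- `M.Run P a c`: the machine passes from `a` to `c`, and `P` holds in every configuration that
it leaves on the way. -/
def Machine.Run (M : Machine I X) (P : M.Config → Prop) : M.Config → M.Config → Prop :=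
  Relation.ReflTransGen fun c d => P c ∧ d ∈ M.next c

theorem Machine.Run.refl : M.Run P a a := Relation.ReflTransGen.refl

theorem Machine.Run.trans (h : M.Run P a c) (h' : M.Run P c d) : M.Run P a d :=
  Relation.ReflTransGen.trans h h'

theorem Machine.Run.reaches (h : M.Run P a c) : StateTransition.Reaches M.next a c :=
  Relation.ReflTransGen.mono (fun _ _ h => h.2) _ _ h

theorem Machine.Run.forall_reaches (h : M.Run P a c) (hc : M.next c = none) (hP : P c)
    (hd : StateTransition.Reaches M.next a d) : P d := by
  induction h using Relation.ReflTransGen.head_induction_on with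
  | refl =>
    rcases Relation.ReflTransGen.cases_head hd with rfl | ⟨b, hb, _⟩
    · exact hP
    · simp [hc] at hb
  | head hab _ ih =>
    rcases Relation.ReflTransGen.cases_head hd with rfl | ⟨b, hb, hbd⟩
    · exact hab.1
    · exact ih (Option.mem_unique hab.2 hb ▸ hbd)

end Runs

section Tapes
variable {α : Type*} {l l' : List α} {n : ℕ}

/-- The tape with the given cells at its left end and blanks beyond. -/
def tape (l : List α) : ℕ → Option α := fun n => l[n]?

theorem tape_append (hn : l.length = n) : tape (l ++ l') n = l'.head? := by
  subst hn
  cases l' <;> simp [tape]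

theorem tape_length (hn : l.length = n) : tape l n = none :=
  List.getElem?_eq_none hn.le

theorem update_of_eq {A : ℕ → Option α} {x : Option α} (h : A n = x) :
    Function.update A n x = A := by
  rw [← h, Function.update_eq_self]

theorem update_tape_append {x y : α} (hn : l.length = n) :
    Function.update (tape (l ++ x :: l')) n (some y) = tape (l ++ y :: l') := by
  funext k
  grind [tape, Function.update_apply]

theorem update_tape_length {x : α} (hn : l.length = n) :
    Function.update (tape l) n (some x) = tape (l ++ [x]) := by
  funext k
  grind [tape, Function.update_apply]

theorem update_tape_dropLast (l : List α) :
    Function.update (tape l) (l.length - 1) none = tape l.dropLast := by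
  funext k
  grind [tape, Function.update_apply]

end Tapes

/-- A program that works in rounds on a word in prefix notation, each symbol of which carries a
digit from `E`. In a round, with a control from `A × J`, it evaluates the word as a term over `R`
from right to left, then writes a header, which depends on the value of the whole word, and a body
for each symbol of the word, which also depends on the value of the term that starts there. The
rounds run through all controls and digits: `J` in the innermost loop, `A` in the outermost. -/
structure Sweeper (I X : Type) where
  E : Type
  R : Type
  A : Type
  J : Type
  finite_E : Finite E
  finite_R : Finite R
  finite_A : Finite A
  finite_J : Finite J
  arity : I → Fin 3
  comb : I → E → R → R → R
  bot : R
  header : A × J → R → List X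
  body : A × J → R → (I × E) × R → List X
  zero : E
  succ : E → Option E
  firstA : A
  nextA : A → Option A
  firstJ : J
  nextJ : J → Option J

namespace Sweeper
variable {I X : Type} (P : Sweeper I X)

/-- The effect of a symbol on the nonempty stack of an evaluation from right to left, given by its
top and the rest; missing arguments are replaced by `bot`. -/
def push (x : I × P.E) (s : P.R × List P.R) : P.R × List P.R :=
  match P.arity x.1 with
  | 0 => (P.comb x.1 x.2 P.bot P.bot, s.1 :: s.2)
  | 1 => (P.comb x.1 x.2 s.1 P.bot, s.2)
  | 2 => (P.comb x.1 x.2 s.1 (s.2.headD P.bot), s.2.tail)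

/-- The stack after the evaluation of a word. -/
def stack (v : List (I × P.E)) : P.R × List P.R := v.foldr P.push (P.bot, [])

/-- The value of a word, which is found on top of the stack. -/
abbrev value (v : List (I × P.E)) : P.R := (P.stack v).1

/-- The word with the values of the terms that start at its symbols. -/
def annotate : List (I × P.E) → List ((I × P.E) × P.R)
  | [] => []
  | x :: v => (x, P.value (x :: v)) :: annotate v

/-- The output of a round. -/
def output (c : P.A × P.J) (v : List (I × P.E)) : List X :=
  P.header c (P.value v) ++ (P.annotate v).flatMap (P.body c (P.value v))

/-- The word with the digits incremented if `k` holds, and whether there is a carry at its end. -/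
def incr (k : Bool) : List (I × P.E) → Bool × List (I × P.E)
  | [] => (k, [])
  | (i, e) :: v =>
    let r := incr (k && (P.succ e).isNone) v
    (r.1, (i, if k then (P.succ e).getD P.zero else e) :: r.2)

variable {P}

theorem length_stack_le (v : List (I × P.E)) : (P.stack v).2.length ≤ v.length := by
  induction v with
  | nil => exact le_rfl
  | cons x v ih =>
    change (P.push x (P.stack v)).2.length ≤ v.length + 1
    unfold push
    split <;> grind

theorem map_fst_annotate (v : List (I × P.E)) : (P.annotate v).map Prod.fst = v := by
  induction v <;> simp_all [annotate]

theorem length_annotate (v : List (I × P.E)) : (P.annotate v).length = v.length := by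
  rw [← List.length_map (f := Prod.fst), map_fst_annotate]

theorem zip_replicate (w : List I) (e : P.E) :
    w.zip (List.replicate w.length e) = w.map (·, e) := by
  induction w <;> simp_all [List.replicate_succ]

theorem incr_false (v : List (I × P.E)) : P.incr false v = (false, v) := by
  induction v <;> simp_all [incr]

theorem length_incr (k : Bool) (v : List (I × P.E)) : (P.incr k v).2.length = v.length := by
  induction v generalizing k <;> simp_all only [incr, List.length_nil, List.length_cons]

theorem incr_true {w : List I} {es : List P.E} (h : es.length = w.length) :
    P.incr true (w.zip es) = match succWord P.succ P.zero es with
      | some es' => (false, w.zip es')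
      | none => (true, w.map (·, P.zero)) := by
  induction w generalizing es with
  | nil => rw [List.eq_nil_of_length_eq_zero h]; rfl
  | cons i w ih =>
    obtain ⟨e, es, rfl⟩ := List.exists_cons_of_length_eq_add_one h
    have := ih (es := es) (by simpa using h)
    cases he : P.succ e <;> cases hes : succWord P.succ P.zero es <;>
      simp_all [incr, succWord, incr_false]

/-- The states of the machine that executes a sweeper. -/
inductive State (P : Sweeper I X) : Type
  | load
  | up (c : P.A × P.J) (r : P.R)
  | pop (c : P.A × P.J) (r : P.R)
  | turn (c : P.A × P.J) (r : P.R)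
  | down (c : P.A × P.J) (r : P.R) (k : Bool)

instance (P : Sweeper I X) : Finite P.State := by
  have := P.finite_A
  have := P.finite_J
  have := P.finite_R
  let f : P.State → Option (Option (Fin 4) × (P.A × P.J) × P.R)
    | .load => none
    | .up c r => some (none, c, r)
    | .pop c r => some (some 0, c, r)
    | .turn c r => some (some 1, c, r)
    | .down c r k => some (some (if k then 2 else 3), c, r)
  refine Finite.of_injective f ?_
  rintro (_ | _ | _ | _ | ⟨_, _, _ | _⟩) (_ | _ | _ | _ | ⟨_, _, _ | _⟩) h <;> simp_all [f]

/-- The symbols that the machine writes: symbols of the word with their digits, possibly with a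
value attached, and values on the stack. -/
abbrev Cell (P : Sweeper I X) : Type := ((I × P.E) × Option P.R) ⊕ P.R

/-- A cell of the word without a value. -/
abbrev plain (x : I × P.E) : I ⊕ P.Cell := .inr (.inl (x, none))

/-- A cell of the word with a value. -/
abbrev marked (x : (I × P.E) × P.R) : I ⊕ P.Cell := .inr (.inl (x.1, some x.2))

/-- A cell of the stack. -/
abbrev onStack (r : P.R) : I ⊕ P.Cell := .inr (.inr r)

/-- The value in a cell of the stack; `bot` at its bottom. -/
def stackValue : Option (I ⊕ P.Cell) → P.R
  | some (.inr (.inr r)) => r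
  | _ => P.bot

/-- The control of the next round; `k` tells whether the digits have overflown. -/
def nextControl (c : P.A × P.J) (k : Bool) : Option (P.A × P.J) :=
  match P.nextJ c.2 with
  | some j => some (c.1, j)
  | none => if k then (P.nextA c.1).map (·, P.firstJ) else some (c.1, P.firstJ)

theorem nextControl_incr {w : List I} {c : (P.A × List P.E) × P.J}
    (hc : c.1.2.length = w.length) :
    let r := P.incr (P.nextJ c.2).isNone (w.zip c.1.2)
    (nextControl (c.1.1, c.2) r.1).map (·, r.2) =
      (succProd (succProd P.nextA (List.replicate w.length P.zero) (succWord P.succ P.zero))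
        P.firstJ P.nextJ c).map fun c => ((c.1.1, c.2), w.zip c.1.2) := by
  cases hj : P.nextJ c.2 with
  | some j => simp [hj, nextControl, succProd, incr_false]
  | none =>
    cases hes : succWord P.succ P.zero c.1.2 <;>
      simp [hj, hes, nextControl, succProd, incr_true hc, zip_replicate, Function.comp_def]

/-- The step function of the machine that executes a sweeper, in terms of the two scanned cells. -/
def step : P.State → Option (I ⊕ P.Cell) → Option (I ⊕ P.Cell) →
    Option (P.State × (Option (I ⊕ P.Cell) × Move) × (Option (I ⊕ P.Cell) × Move) × List X)
  | .load, some (.inl i), b => some (.load, (some (plain (i, P.zero)), .right), (b, .stay), [])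
  | .load, a, b => some (.up (P.firstA, P.firstJ) P.bot, (a, .left), (b, .stay), [])
  | .up c r, some (.inr (.inl (x, none))), b =>
    match P.arity x.1 with
    | 0 =>
      let r' := P.comb x.1 x.2 P.bot P.bot
      some (.up c r', (some (marked (x, r')), .left), (some (onStack r), .right), [])
    | 1 =>
      let r' := P.comb x.1 x.2 r P.bot
      some (.up c r', (some (marked (x, r')), .left), (b, .stay), [])
    | 2 => some (.pop c r, (some (plain x), .stay), (b, .left), [])
  | .up c r, a, b => some (.turn c r, (a, .stay), (b, .left), [])
  | .pop c r, some (.inr (.inl (x, none))), b =>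
    let r' := P.comb x.1 x.2 r (stackValue b)
    some (.up c r', (some (marked (x, r')), .left), (none, .stay), [])
  | .pop _ _, _, _ => none
  | .turn c r, a, some _ => some (.turn c r, (a, .stay), (none, .left), [])
  | .turn c r, a, none =>
    some (.down c r (P.nextJ c.2).isNone, (a, .stay), (none, .stay), P.header c r)
  | .down c r k, some (.inr (.inl (x, some s))), b =>
    some (.down c r (k && (P.succ x.2).isNone),
      (some (plain (x.1, if k then (P.succ x.2).getD P.zero else x.2)), .right), (b, .stay),
      P.body c r (x, s))
  | .down c _ k, a, b =>
    (nextControl c k).map fun c' => (.up c' P.bot, (a, .left), (b, .stay), [])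

theorem step_down_none (c : P.A × P.J) (r : P.R) (k : Bool) (b : Option (I ⊕ P.Cell)) :
    step (.down c r k) none b =
      (nextControl c k).map fun c' => (.up c' P.bot, (none, .left), (b, .stay), []) := rfl

theorem stackValue_tape (s : List P.R) :
    stackValue (tape (s.map (onStack (P := P))).reverse (s.length - 1)) = s.headD P.bot := by
  cases s <;> simp [tape, stackValue]

variable [Finite I]

/-- The machine that executes a sweeper. Tape `0` holds the word; tape `1` holds the stack except
for its top, which is part of the state. -/
def machine (P : Sweeper I X) : Machine I X where
  k := 1
  Γ := P.Cell
  finite_Γ := by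
    have := P.finite_E
    have := P.finite_R
    infer_instance
  S := P.State
  finite_S := inferInstance
  start := .load
  step s x := (step s (x 0) (x 1)).map fun a => (a.1, ![a.2.1, a.2.2.1], a.2.2.2)

/-- The configuration with given state, tapes, heads and output. -/
def conf (s : P.State) (A : ℕ → Option (I ⊕ P.Cell)) (h : ℕ) (B : ℕ → Option (I ⊕ P.Cell))
    (h' : ℕ) (out : List X) : P.machine.Config :=
  ⟨s, ![A, B], ![h, h'], out⟩

/-- The heads are among the first `n + 1` cells of their tapes. -/
def Within (n : ℕ) (c : P.machine.Config) : Prop := ∀ i, c.head i < n + 1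

theorem initial_eq_conf (w : List I) :
    P.machine.initial w = conf .load (tape (w.map .inl)) 0 (tape []) 0 [] := by
  refine congrArg₂ (Machine.Config.mk _ · · _) (funext <| Fin.forall_fin_two.2 ⟨?_, rfl⟩)
    (funext <| Fin.forall_fin_two.2 ⟨rfl, rfl⟩)
  exact funext fun n => List.getElem?_map.symm

variable {s s' : P.State} {A B : ℕ → Option (I ⊕ P.Cell)} {h h' n : ℕ}
  {x y : Option (I ⊕ P.Cell)} {m m' : Move} {out o : List X}

theorem within_conf (hh : h ≤ n) (hh' : h' ≤ n) : Within n (conf s A h B h' out) :=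
  Fin.forall_fin_two.2 ⟨Nat.lt_succ_of_le hh, Nat.lt_succ_of_le hh'⟩

theorem next_conf :
    P.machine.next (conf s A h B h' out) = (step s (A h) (B h')).map fun t =>
      conf t.1 (Function.update A h t.2.1.1) (t.2.1.2.apply h) (Function.update B h' t.2.2.1.1)
        (t.2.2.1.2.apply h') (out ++ t.2.2.2) := by
  refine Option.map_map .. |>.trans (congrFun (congrArg Option.map (funext fun t => ?_)) _)
  exact congrArg₂ (Machine.Config.mk _ · · _) (funext <| Fin.forall_fin_two.2 ⟨rfl, rfl⟩)
    (funext <| Fin.forall_fin_two.2 ⟨rfl, rfl⟩)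

theorem run_step {A' B' : ℕ → Option (I ⊕ P.Cell)} {a b : Option (I ⊕ P.Cell)} (ha : A h = a)
    (hb : B h' = b) (hs : step s a b = some (s', (x, m), (y, m'), o))
    (hA : Function.update A h x = A') (hB : Function.update B h' y = B') (hh : h ≤ n)
    (hh' : h' ≤ n) :
    P.machine.Run (Within n) (conf s A h B h' out)
      (conf s' A' (m.apply h) B' (m'.apply h') (out ++ o)) :=
  .single ⟨within_conf hh hh', by rw [next_conf, ha, hb, hs, ← hA, ← hB]; rfl⟩

theorem run_load (v : List (I × P.E)) (w : List I) (hn : v.length + w.length = n) :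
    P.machine.Run (Within n)
      (conf .load (tape (v.map plain ++ w.map .inl)) v.length (tape []) 0 [])
      (conf (.up (P.firstA, P.firstJ) P.bot) (tape ((v ++ w.map (·, P.zero)).map plain)) (n - 1)
        (tape []) 0 []) := by
  induction w generalizing v with
  | nil =>
    have scanned : tape (v.map (plain (P := P)) ++ [].map .inl) v.length = none :=
      tape_append (by simp)
    simpa [Move.apply, ← hn] using run_step (s := .load) (out := []) scanned
      (B := tape []) (h' := 0) rfl rfl (update_of_eq scanned) (update_of_eq rfl)
      (hn ▸ Nat.le_add_right ..) n.zero_le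
  | cons i w ih =>
    refine Machine.Run.trans (run_step (h' := 0) (tape_append (by simp)) rfl rfl
      (update_tape_append (by simp)) (update_of_eq rfl) (by omega) n.zero_le) ?_
    simpa [Move.apply] using ih (v ++ [(i, P.zero)]) (by simp at hn ⊢; omega)

theorem run_push (c : P.A × P.J) (out : List X) (u : List (I × P.E)) (x : I × P.E)
    (y : List ((I × P.E) × P.R)) (s : P.R × List P.R) (hu : u.length ≤ n) (hs : s.2.length ≤ n) :
    P.machine.Run (Within n)
      (conf (.up c s.1) (tape (u.map plain ++ plain x :: y.map marked)) u.length
        (tape (s.2.map onStack).reverse) s.2.length out)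
      (conf (.up c (P.push x s).1)
        (tape (u.map plain ++ marked (x, (P.push x s).1) :: y.map marked)) (u.length - 1)
        (tape ((P.push x s).2.map onStack).reverse) (P.push x s).2.length out) := by
  have scanned : tape (u.map plain ++ plain x :: y.map marked) u.length = some (plain x) :=
    tape_append (by simp)
  have above_top : tape (s.2.map (onStack (P := P))).reverse s.2.length = none :=
    tape_length (by simp)
  match ha : P.arity x.1 with
  | 0 =>
    have pushed := run_step (s := .up c s.1) (out := out) scanned above_top
      (by simp only [step, ha]; rfl) (update_tape_append (by simp)) (update_tape_length (by simp))
      hu hs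
    simpa [push, ha, Move.apply] using pushed
  | 1 =>
    have replaced := run_step (s := .up c s.1) (out := out) scanned above_top
      (by simp only [step, ha]; rfl) (update_tape_append (by simp)) (update_of_eq above_top) hu hs
    simpa [push, ha, Move.apply] using replaced
  | 2 =>
    have drop_top : Function.update (tape (s.2.map (onStack (P := P))).reverse) (s.2.length - 1)
        none = tape (s.2.tail.map onStack).reverse := by
      simpa using update_tape_dropLast (s.2.map (onStack (P := P))).reverse
    refine (run_step (s := .up c s.1) scanned above_top (by simp only [step, ha]; rfl)
      (update_of_eq scanned) (update_of_eq above_top) hu hs).trans ?_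
    simpa [push, ha, Move.apply, stackValue_tape] using
      run_step (s := .pop c s.1) (out := out) scanned rfl rfl (update_tape_append (by simp))
        drop_top hu ((Nat.sub_le ..).trans hs)

theorem run_up (c : P.A × P.J) (out : List X) (u v : List (I × P.E))
    (hn : u.length + v.length = n) :
    P.machine.Run (Within n)
      (conf (.up c P.bot) (tape ((u ++ v).map plain)) (n - 1) (tape []) 0 out)
      (conf (.up c (P.stack v).1) (tape (u.map plain ++ (P.annotate v).map marked)) (u.length - 1)
        (tape ((P.stack v).2.map onStack).reverse) (P.stack v).2.length out) := by
  induction v generalizing u with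
  | nil =>
    simp only [List.length_nil, Nat.add_zero] at hn
    simpa [stack, annotate, hn] using Machine.Run.refl
  | cons x v ih =>
    have length_le := length_stack_le v
    rw [List.length_cons] at hn
    refine Machine.Run.trans (by simpa using ih (u ++ [x]) (by simp; omega))
      (run_push c out u x (P.annotate v) (P.stack v) (by omega) (by omega))

theorem run_turn (c : P.A × P.J) (r : P.R) (out : List X) {A : ℕ → Option (I ⊕ P.Cell)}
    (l : List (I ⊕ P.Cell)) (hl : l.length ≤ n) :
    P.machine.Run (Within n) (conf (.turn c r) A 0 (tape l) (l.length - 1) out)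
      (conf (.down c r (P.nextJ c.2).isNone) A 0 (tape []) 0 (out ++ P.header c r)) := by
  induction l using List.reverseRecOn with
  | nil =>
    exact run_step (s := .turn c r) (A := A) (B := tape []) rfl rfl rfl (update_of_eq rfl)
      (update_of_eq rfl) n.zero_le n.zero_le
  | append_singleton l z ih =>
    have scanned : tape (l ++ [z]) ((l ++ [z]).length - 1) = some z := tape_append (by simp)
    refine (run_step (s := .turn c r) rfl scanned rfl (update_of_eq rfl) (update_tape_dropLast _)
      n.zero_le (by omega)).trans ?_
    simpa [Move.apply] using ih (by simp at hl; omega)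

theorem run_down (c : P.A × P.J) (r : P.R) (k : Bool) (out : List X) (u : List (I × P.E))
    (y : List ((I × P.E) × P.R)) (hn : u.length + y.length = n) :
    P.machine.Run (Within n)
      (conf (.down c r k) (tape (u.map plain ++ y.map marked)) u.length (tape []) 0 out)
      (conf (.down c r (P.incr k (y.map Prod.fst)).1)
        (tape ((u ++ (P.incr k (y.map Prod.fst)).2).map plain)) n (tape []) 0
        (out ++ y.flatMap (P.body c r))) := by
  induction y generalizing u k out with
  | nil => simpa [incr, ← hn] using Machine.Run.refl
  | cons z y ih =>
    obtain ⟨⟨i, e⟩, s⟩ := z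
    rw [List.length_cons] at hn
    refine (run_step (h' := 0) (s := .down c r k) (tape_append (by simp)) rfl rfl
      (update_tape_append (by simp)) (update_of_eq rfl) (by omega) n.zero_le).trans ?_
    simpa [Move.apply, incr] using ih (k && (P.succ e).isNone)
      (out ++ P.body c r ((i, e), s)) (u ++ [(i, if k then (P.succ e).getD P.zero else e)])
      (by simp; omega)

theorem run_round (c : P.A × P.J) (out : List X) (v : List (I × P.E)) (hn : v.length = n) :
    P.machine.Run (Within n) (conf (.up c P.bot) (tape (v.map plain)) (n - 1) (tape []) 0 out)
      (conf (.down c (P.stack v).1 (P.incr (P.nextJ c.2).isNone v).1)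
        (tape ((P.incr (P.nextJ c.2).isNone v).2.map plain)) n (tape []) 0
        (out ++ P.output c v)) := by
  set A := tape ((P.annotate v).map (marked (P := P))) with hA
  set st := ((P.stack v).2.map (onStack (P := P))).reverse with hst
  have length_st : st.length = (P.stack v).2.length := by simp [hst]
  have st_le : st.length ≤ n := length_st ▸ hn ▸ length_stack_le v
  have at_left_end (b) : step (.up c (P.stack v).1) (A 0) b =
      some (.turn c (P.stack v).1, (A 0, .stay), (b, .left), []) := by
    cases v <;> rfl
  have up := run_up c out [] v (by simpa using hn)
  have turned := run_step (out := out) rfl rfl (at_left_end (tape st st.length)) (update_of_eq rfl)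
    (update_of_eq rfl) n.zero_le st_le
  have cleared := run_turn c (P.stack v).1 out (A := A) st st_le
  have down := run_down c (P.stack v).1 (P.nextJ c.2).isNone (out ++ P.header c (P.stack v).1) []
    (P.annotate v) (by simpa [length_annotate] using hn)
  rw [map_fst_annotate] at down
  rw [length_st] at turned
  refine Machine.Run.trans (by simpa using up)
    (Machine.Run.trans (by simpa [Move.apply] using turned) ?_)
  rw [← length_st]
  exact cleared.trans (by simpa [output] using down)

theorem run_rounds {w : List I} {c : (P.A × List P.E) × P.J} {L : List ((P.A × List P.E) × P.J)}
    (h : Enumerates (succProd (succProd P.nextA (List.replicate w.length P.zero)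
      (succWord P.succ P.zero)) P.firstJ P.nextJ) c L)
    (hL : ∀ c ∈ L, c.1.2.length = w.length) (out : List X) :
    ∃ d, P.machine.Run (Within w.length) (conf (.up (c.1.1, c.2) P.bot)
        (tape ((w.zip c.1.2).map plain)) (w.length - 1) (tape []) 0 out) d ∧
      Within w.length d ∧ P.machine.next d = none ∧
      d.out = out ++ L.flatMap fun c => P.output (c.1.1, c.2) (w.zip c.1.2) := by
  have round {c : (P.A × List P.E) × P.J} (hc : c.1.2.length = w.length) (out : List X) :=
    run_round (n := w.length) (c.1.1, c.2) out (w.zip c.1.2) (by simp [hc])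
  have at_right_end {c : (P.A × List P.E) × P.J} (hc : c.1.2.length = w.length) (k : Bool) :
      tape ((P.incr k (w.zip c.1.2)).2.map plain) w.length = none :=
    tape_length (by simp [length_incr, hc])
  induction h generalizing out with
  | @last c hc =>
    have length_c := hL c (by simp)
    have control := nextControl_incr length_c
    simp only [hc, Option.map_none, Option.map_eq_none_iff] at control
    refine ⟨_, round length_c out, within_conf le_rfl (Nat.zero_le _), ?_, by simp [conf]⟩
    rw [next_conf, at_right_end length_c, step_down_none, control]
    rfl
  | @step c c' L hc _ ih =>
    have length_c := hL c (by simp)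
    have control := nextControl_incr length_c
    simp only [hc, Option.map_some, Option.map_eq_some_iff, Prod.mk.injEq] at control
    obtain ⟨_, hnext, rfl, hword⟩ := control
    obtain ⟨d, hd, hd'⟩ := ih (fun c hc => hL c (List.mem_cons_of_mem _ hc))
      (out ++ P.output (c.1.1, c.2) (w.zip c.1.2))
    have right_end := at_right_end length_c (P.nextJ c.2).isNone
    have turned := run_step (n := w.length) (B := tape []) (h' := 0)
      (out := out ++ P.output (c.1.1, c.2) (w.zip c.1.2)) right_end rfl
      (s := .down _ (P.stack (w.zip c.1.2)).1 _) (by rw [step_down_none, hnext]; rfl)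
      (update_of_eq right_end) (update_of_eq rfl) le_rfl (Nat.zero_le _)
    rw [← hword] at hd
    rw [List.append_nil] at turned
    exact ⟨d, (round length_c out).trans (Machine.Run.trans turned hd), by simpa using hd'⟩

theorem machine_spec {as : List P.A} {js : List P.J} {w : List I} {ws : List (List P.E)}
    (has : Enumerates P.nextA P.firstA as) (hjs : Enumerates P.nextJ P.firstJ js)
    (hws : Enumerates (succWord P.succ P.zero) (List.replicate w.length P.zero) ws)
    (hlen : ∀ es ∈ ws, es.length = w.length) :
    P.machine.HaltsWith w (((as ×ˢ ws) ×ˢ js).flatMap fun c =>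
        P.output (c.1.1, c.2) (w.zip c.1.2)) ∧
      P.machine.UsesSpace w (2 * w.length + 2) := by
  obtain ⟨d, hd, within, halts, hout⟩ := run_rounds ((has.prod hws).prod hjs)
    (fun c hc => hlen _ (List.mem_product.1 (List.mem_product.1 hc).1).2) []
  have run : P.machine.Run (Within w.length) (P.machine.initial w) d := by
    refine Machine.Run.trans ?_ hd
    simpa [initial_eq_conf, zip_replicate] using run_load (P := P) [] w (Nat.zero_add _)
  refine ⟨⟨d, run.reaches, halts, by simpa using hout⟩, fun _ => w.length + 1, ?_, fun c hc => ?_⟩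
  · change ∑ i : Fin 2, _ ≤ _
    rw [Fin.sum_univ_two]; omega
  · exact run.forall_reaches halts within hc

end Sweeper

namespace Sweeper
variable {I X : Type} {P : Sweeper I X} {x : I × P.E} {u v : List (I × P.E)}

/-- The words of terms in prefix notation. -/
inductive IsTerm (P : Sweeper I X) : List (I × P.E) → Prop
  | leaf {x : I × P.E} : P.arity x.1 = 0 → P.IsTerm [x]
  | unary {x : I × P.E} {u : List (I × P.E)} : P.arity x.1 = 1 → P.IsTerm u → P.IsTerm (x :: u)
  | binary {x : I × P.E} {u v : List (I × P.E)} :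
      P.arity x.1 = 2 → P.IsTerm u → P.IsTerm v → P.IsTerm (x :: (u ++ v))

theorem stack_cons (x : I × P.E) (v : List (I × P.E)) : P.stack (x :: v) = P.push x (P.stack v) :=
  rfl

theorem IsTerm.stack_append (hu : P.IsTerm u) (v : List (I × P.E)) :
    P.stack (u ++ v) = (P.value u, P.value v :: (P.stack v).2) := by
  induction hu generalizing v with
  | leaf hx => simp [value, stack_cons, push, hx]
  | unary hx _ ih => simp [value, stack_cons, push, hx, ih]
  | binary hx _ _ ih₁ ih₂ => simp [value, stack_cons, push, hx, ih₁, ih₂]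

theorem IsTerm.annotate_append (hu : P.IsTerm u) (v : List (I × P.E)) :
    P.annotate (u ++ v) = P.annotate u ++ P.annotate v := by
  have value_append {u : List (I × P.E)} (hu : P.IsTerm u) (v : List (I × P.E)) :
      P.value (u ++ v) = P.value u := by
    rw [value, hu.stack_append]
  induction hu generalizing v with
  | leaf hx => simpa [annotate] using value_append (.leaf hx) v
  | unary hx hu ih => simpa [annotate, ih] using value_append (.unary hx hu) v
  | binary hx hu hv ih₁ ih₂ =>
    simpa [annotate, ih₁, ih₂] using value_append (.binary hx hu hv) v

theorem value_leaf (hx : P.arity x.1 = 0) : P.value [x] = P.comb x.1 x.2 P.bot P.bot := by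
  simp [value, push, hx, stack]

theorem value_unary (hx : P.arity x.1 = 1) :
    P.value (x :: u) = P.comb x.1 x.2 (P.value u) P.bot := by
  simp [value, stack_cons, push, hx]

theorem IsTerm.value_binary (hu : P.IsTerm u) (hx : P.arity x.1 = 2) :
    P.value (x :: (u ++ v)) = P.comb x.1 x.2 (P.value u) (P.value v) := by
  simp [value, stack_cons, push, hx, hu.stack_append]

end Sweeper

/-! ## Writing the automaton -/

section Representatives
variable {α β : Type*} {f : α → β} {x y : α}

/-- A set of representatives of the fibres of `f`. -/
def representatives (f : α → β) : Set α := Set.range (Set.rangeSplitting f)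

theorem exists_mem_representatives (f : α → β) (x : α) : ∃ y ∈ representatives f, f y = f x :=
  ⟨_, Set.mem_range_self ⟨f x, x, rfl⟩, Set.apply_rangeSplitting f _⟩

theorem eq_of_mem_representatives (hx : x ∈ representatives f) (hy : y ∈ representatives f)
    (h : f x = f y) : x = y := by
  obtain ⟨a, rfl⟩ := hx
  obtain ⟨b, rfl⟩ := hy
  rw [Set.apply_rangeSplitting f, Set.apply_rangeSplitting f] at h
  rw [Subtype.ext h]

end Representatives

section Evaluation
variable {V Ch D K CV : Type}

/-- The digit at a position of a formula: the entries of two automaton states there. -/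
abbrev Digit : Type := Entry × Entry

/-- The word whose first symbol is at position `p`, with the digits from `g`. -/
def decorate {I E : Type*} (g : ℕ → E) (w : List I) (p : ℕ) : List (I × E) :=
  (w.zipIdx p).map (Prod.map id g)

@[simp]
theorem decorate_nil {I E : Type*} (g : ℕ → E) (p : ℕ) : decorate g ([] : List I) p = [] := rfl

@[simp]
theorem decorate_cons {I E : Type*} (g : ℕ → E) (i : I) (w : List I) (p : ℕ) :
    decorate g (i :: w) p = (i, g p) :: decorate g w (p + 1) := rfl

@[simp]
theorem decorate_append {I E : Type*} (g : ℕ → E) (w w' : List I) (p : ℕ) :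
    decorate g (w ++ w') p = decorate g w p ++ decorate g w' (p + w.length) := by
  simp [decorate, List.zipIdx_append]

theorem zip_ofFn {I E : Type*} (w : List I) (f : Fin w.length → E) (g : ℕ → E)
    (h : ∀ k : Fin w.length, g k = f k) : w.zip (List.ofFn f) = decorate g w 0 := by
  refine List.ext_getElem (by simp [decorate]) fun k hk hk' => ?_
  simp [decorate, ← h]

/-- What a formula or descriptor and the entries of two states at its positions determine. -/
structure Val (V Ch D K CV : Type) where
  root : Digit
  clear : Prop
  diag : Prop
  sem : Set (Observation Ch D K CV)
  cls : Observation Ch D K CV → Set (Observation Ch D K CV)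
  ok : (V → Bool) × Observation Ch D K CV → Prop → Prop

instance [Finite Ch] [Finite D] [Finite K] [Finite CV] : Finite (Observation Ch D K CV) := by
  refine Finite.of_injective (fun m => (m.ch, m.data, m.sender, m.pred)) ?_
  rintro ⟨⟩ ⟨⟩ h
  simp_all

instance [Finite V] [Finite Ch] [Finite D] [Finite K] [Finite CV] :
    Finite (Val V Ch D K CV) := by
  refine Finite.of_injective (fun v => (v.root, v.clear, v.diag, v.sem, v.cls, v.ok)) ?_
  rintro ⟨⟩ ⟨⟩ h
  simp_all

/-- The value of a missing argument. -/
def Val.bot : Val V Ch D K CV where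
  root := (⟨false, true⟩, ⟨false, true⟩)
  clear := True
  diag := True
  sem := ∅
  cls _ := Set.univ
  ok _ _ := True

/-- The number of arguments of a symbol. -/
def Token.arity : Token V Ch D K CV → Fin 3
  | .cv _ | .ncv _ | .ch _ | .nch _ | .agent _ | .nagent _ | .data _ | .ndata _ => 0
  | .var _ | .nvar _ => 0
  | .ex | .all => 1
  | _ => 2

/-- The observations that satisfy a descriptor with the given first symbol, in terms of those that
satisfy its arguments; those that satisfy `O` for a formula `⟨O⟩ φ` or `[O] φ`. -/
def Token.sem (r s : Set (Observation Ch D K CV)) :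
    Token V Ch D K CV → Set (Observation Ch D K CV)
  | .cv x => {m | (Descriptor.cv x).Sat m}
  | .ncv x => {m | (Descriptor.ncv x).Sat m}
  | .ch a => {m | (Descriptor.ch a).Sat m}
  | .nch a => {m | (Descriptor.nch a).Sat m}
  | .agent k => {m | (Descriptor.agent k).Sat m}
  | .nagent k => {m | (Descriptor.nagent k).Sat m}
  | .data d => {m | (Descriptor.data d).Sat m}
  | .ndata d => {m | (Descriptor.ndata d).Sat m}
  | .ex => {m | ∃ c ∈ m.pred, { m with pred := {c} } ∈ r}
  | .all => {m | ∀ c ∈ m.pred, { m with pred := {c} } ∈ r}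
  | .descOr => r ∪ s
  | .descAnd => r ∩ s
  | .possible | .necessary => r
  | _ => ∅

/-- The condition of `Formula.LocalStep` on a symbol with digit `e` and the values `r` and `s` of
its arguments. -/
def Token.ok (a : (V → Bool) × Observation Ch D K CV) (acc : Prop) (e : Digit)
    (r s : Val V Ch D K CV) : Token V Ch D K CV → Prop
  | .var v => e.1.due → a.1 v
  | .nvar v => e.1.due → ¬ a.1 v
  | .or => e.1.due → r.root.1.due ∨ s.root.1.due
  | .and => e.1.due → r.root.1.due ∧ s.root.1.due
  | .until =>
    (e.1.due → s.root.1.due ∨ r.root.1.due ∧ e.2.due) ∧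
      (e.2.clear → (e.2.due → s.root.2.due) ∨ e.1.clear ∧ ¬ acc)
  | .release => e.1.due → s.root.1.due ∧ (r.root.1.due ∨ e.2.due)
  | .possible => e.1.due → a.2 ∈ r.sem ∧ s.root.2.due
  | .necessary => e.1.due → a.2 ∈ r.sem → s.root.2.due
  | _ => True

/-- The observations not separated from `m` by the top-level descriptors of a formula with the
given first symbol, in terms of the values of its arguments. -/
def Token.cls (r s : Val V Ch D K CV) (m : Observation Ch D K CV) :
    Token V Ch D K CV → Set (Observation Ch D K CV)
  | .possible | .necessary => {m' | m ∈ r.sem ↔ m' ∈ r.sem} ∩ s.cls m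
  | _ => r.cls m ∩ s.cls m

/-- The value of a term in terms of its first symbol, the digit there and the values of its
arguments. -/
def Val.comb (i : Token V Ch D K CV) (e : Digit) (r s : Val V Ch D K CV) : Val V Ch D K CV where
  root := e
  clear := e.1.clear ∧ r.clear ∧ s.clear
  diag := e.1 = e.2 ∧ r.diag ∧ s.diag
  sem := i.sem r.sem s.sem
  cls m := i.cls r s m
  ok a acc := i.ok a acc e r s ∧ r.ok a acc ∧ s.ok a acc

/-- The control of a round: the record of a state if there is no first component, and else of a
transition on the given letter; and the part of the record to write. -/
abbrev Control (V Ch D K CV : Type) : Type :=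
  Option ((V → Bool) × Observation Ch D K CV) × Fin 3

/-- A record is written if its two states are equal for a state, and if it is a transition for a
transition; for each set of descriptors, one observation that satisfies exactly these is
considered. -/
def Val.Admits (v : Val V Ch D K CV) : Option ((V → Bool) × Observation Ch D K CV) → Prop
  | none => v.diag
  | some a => v.ok a v.clear ∧ a.2 ∈ representatives v.cls

/-- The name of an entry. -/
def Entry.bits (e : Entry) : List Bool := [e.due, e.clear]

open Classical in
/-- The symbols at the beginning of a part of a record. -/
noncomputable def Val.header (v : Val V Ch D K CV) : Control V Ch D K CV → List (OutSym V)
  | (none, 0) => [.state, .bit v.root.1.due, .bit v.clear]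
  | (some _, 0) => [.trans]
  | (some a, 1) => [.letter a.1]
  | (some _, 2) => [.arrow]
  | _ => []

open Classical in
/-- The bit for a top-level descriptor, given the first symbol of the formula that it belongs to. -/
noncomputable def Token.obsBit (m : Observation Ch D K CV) (v : Val V Ch D K CV) :
    Token V Ch D K CV → List (OutSym V)
  | .possible | .necessary => [.bit (decide (m ∈ v.sem))]
  | _ => []

/-- The symbols that a symbol of the formula contributes to a part of a record. -/
noncomputable def cellOutput (x : (Token V Ch D K CV × Digit) × Val V Ch D K CV) :
    Control V Ch D K CV → List (OutSym V)
  | (_, 0) => x.1.2.1.bits.map .bit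
  | (some a, 1) => x.1.1.obsBit a.2 x.2
  | (some _, 2) => x.1.2.2.bits.map .bit
  | _ => []

variable [Finite V] [Finite Ch] [Finite D] [Finite K] [Finite CV]

open Classical in
/-- The program that writes the automaton of a formula, by running through all pairs of states, and
for each letter again through all pairs of states. -/
noncomputable abbrev writer (zero : Digit) (succ : Digit → Option Digit)
    (next : Option ((V → Bool) × Observation Ch D K CV) →
      Option (Option ((V → Bool) × Observation Ch D K CV))) :
    Sweeper (Token V Ch D K CV) (OutSym V) where
  E := Digit
  R := Val V Ch D K CV
  A := Option ((V → Bool) × Observation Ch D K CV)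
  J := Fin 3
  finite_E := inferInstance
  finite_R := inferInstance
  finite_A := inferInstance
  finite_J := inferInstance
  arity := Token.arity
  comb := Val.comb
  bot := Val.bot
  header c v := if v.Admits c.1 then v.header c else []
  body c v x := if v.Admits c.1 then cellOutput x c else []
  zero := zero
  succ := succ
  firstA := none
  nextA := next
  firstJ := 0
  nextJ := ![some 1, some 2, none]

end Evaluation

section Values
variable {V Ch D K CV : Type} [Finite V] [Finite Ch] [Finite D] [Finite K] [Finite CV]
  {zero : Digit} {succ : Digit → Option Digit}
  {next : Option ((V → Bool) × Observation Ch D K CV) →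
    Option (Option ((V → Bool) × Observation Ch D K CV))}
  {g : ℕ → Digit} {p : ℕ}

local notation "P" => writer zero succ next

theorem Descriptor.isTerm_decorate (O : Descriptor Ch D K CV) :
    (P).IsTerm (decorate g (O.word (V := V)) p) := by
  induction O generalizing p with
  | ex O ih | all O ih => exact .unary rfl ih
  | or O₁ O₂ ih₁ ih₂ | and O₁ O₂ ih₁ ih₂ =>
    rw [Descriptor.word, decorate_cons, decorate_append]
    exact .binary rfl ih₁ ih₂
  | _ => exact .leaf rfl

theorem Formula.isTerm_decorate (φ : Formula V Ch D K CV) :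
    (P).IsTerm (decorate g φ.word p) := by
  induction φ generalizing p with
  | var v | nvar v => exact .leaf rfl
  | or φ ψ ih₁ ih₂ | and φ ψ ih₁ ih₂ | strongUntil φ ψ ih₁ ih₂ | release φ ψ ih₁ ih₂ =>
    rw [Formula.word, decorate_cons, decorate_append]
    exact .binary rfl ih₁ ih₂
  | possible O φ ih | necessary O φ ih =>
    rw [Formula.word, decorate_cons, decorate_append]
    exact .binary rfl O.isTerm_decorate ih

theorem Descriptor.sem_value (O : Descriptor Ch D K CV) :
    ((P).value (decorate g (O.word (V := V)) p)).sem = {m | O.Sat m} := by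
  induction O generalizing p with
  | ex O ih | all O ih =>
    rw [Descriptor.word, decorate_cons, Sweeper.value_unary rfl]
    simp only [Val.comb, Token.sem, ih]
    rfl
  | or O₁ O₂ ih₁ ih₂ | and O₁ O₂ ih₁ ih₂ =>
    rw [Descriptor.word, decorate_cons, decorate_append, O₁.isTerm_decorate.value_binary rfl]
    simp only [Val.comb, Token.sem, ih₁, ih₂]
    rfl
  | _ => rfl

theorem Descriptor.ok_value (O : Descriptor Ch D K CV) (a : (V → Bool) × Observation Ch D K CV)
    (acc : Prop) : ((P).value (decorate g O.word p)).ok a acc := by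
  induction O generalizing p with
  | ex O ih | all O ih =>
    rw [Descriptor.word, decorate_cons, Sweeper.value_unary rfl]
    exact ⟨trivial, ih, trivial⟩
  | or O₁ O₂ ih₁ ih₂ | and O₁ O₂ ih₁ ih₂ =>
    rw [Descriptor.word, decorate_cons, decorate_append, O₁.isTerm_decorate.value_binary rfl]
    exact ⟨trivial, ih₁, ih₂⟩
  | _ => exact ⟨trivial, trivial, trivial⟩

theorem Formula.root_value (φ : Formula V Ch D K CV) :
    ((P).value (decorate g φ.word p)).root = g p := by
  have root_value_cons (x : Token V Ch D K CV × Digit) (u) : ((P).value (x :: u)).root = x.2 := by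
    rw [Sweeper.value, Sweeper.stack_cons, Sweeper.push]
    split <;> rfl
  cases φ <;> exact root_value_cons ..

theorem Formula.mem_cls_value {φ : Formula V Ch D K CV} {m m' : Observation Ch D K CV} :
    m' ∈ ((P).value (decorate g φ.word p)).cls m ↔ φ.obsSet m = φ.obsSet m' := by
  rw [Formula.obsSet_eq_iff]
  induction φ generalizing p with
  | var v | nvar v =>
    rw [Formula.word, decorate_cons, decorate_nil, Sweeper.value_leaf rfl]
    simp [Val.comb, Token.cls, Val.bot, Formula.descriptors]
  | or φ ψ ih₁ ih₂ | and φ ψ ih₁ ih₂ | strongUntil φ ψ ih₁ ih₂ | release φ ψ ih₁ ih₂ =>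
    rw [Formula.word, decorate_cons, decorate_append, φ.isTerm_decorate.value_binary rfl,
      Formula.descriptors, List.forall_mem_append]
    exact and_congr ih₁ ih₂
  | possible O φ ih | necessary O φ ih =>
    rw [Formula.word, decorate_cons, decorate_append, O.isTerm_decorate.value_binary rfl,
      Formula.descriptors, List.forall_mem_cons]
    simp only [Val.comb, Token.cls, O.sem_value]
    exact and_congr Iff.rfl ih

theorem Formula.ok_value (φ : Formula V Ch D K CV) (a : (V → Bool) × Observation Ch D K CV)
    (acc : Prop) : ((P).value (decorate g φ.word p)).ok a acc ↔
      φ.All (Formula.LocalStep a acc (fun k => (g k).1) (fun k => (g k).2)) p := by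
  induction φ generalizing p with
  | var v | nvar v =>
    rw [Formula.word, decorate_cons, decorate_nil, Sweeper.value_leaf rfl]
    simp [Val.comb, Token.ok, Val.bot, Formula.All, Formula.LocalStep]
  | or φ ψ ih₁ ih₂ | and φ ψ ih₁ ih₂ | strongUntil φ ψ ih₁ ih₂ | release φ ψ ih₁ ih₂ =>
    rw [Formula.word, decorate_cons, decorate_append, φ.isTerm_decorate.value_binary rfl]
    simp only [Val.comb, Token.ok, φ.root_value, ψ.root_value, ih₁, ih₂]
    rfl
  | possible O φ ih | necessary O φ ih =>
    rw [Formula.word, decorate_cons, decorate_append, O.isTerm_decorate.value_binary rfl]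
    simp only [Val.comb, Token.ok, φ.root_value, ih, O.sem_value, O.ok_value, true_and,
      O.length_word]
    rfl

open Classical in
theorem Formula.flatMap_obsBit (φ : Formula V Ch D K CV) (m : Observation Ch D K CV) :
    ((P).annotate (decorate g φ.word p)).flatMap (fun x => x.1.1.obsBit m x.2) =
      φ.descriptors.map fun O => .bit (decide (O.Sat m)) := by
  have nil_of_descriptor (O : Descriptor Ch D K CV) (p : ℕ) :
      ((P).annotate (decorate g (O.word (V := V)) p)).flatMap (fun x => x.1.1.obsBit m x.2) =
        [] := by
    induction O generalizing p with
    | or O₁ O₂ ih₁ ih₂ | and O₁ O₂ ih₁ ih₂ =>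
      rw [Descriptor.word, decorate_cons, decorate_append, Sweeper.annotate, List.flatMap_cons,
        O₁.isTerm_decorate.annotate_append, List.flatMap_append, ih₁, ih₂]
      rfl
    | ex _ ih | all _ ih => exact ih (p + 1)
    | _ => rfl
  induction φ generalizing p with
  | var v | nvar v => rfl
  | or φ ψ ih₁ ih₂ | and φ ψ ih₁ ih₂ | strongUntil φ ψ ih₁ ih₂ | release φ ψ ih₁ ih₂ =>
    rw [Formula.word, decorate_cons, decorate_append, Sweeper.annotate, List.flatMap_cons,
      φ.isTerm_decorate.annotate_append, List.flatMap_append, ih₁, ih₂, Formula.descriptors,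
      List.map_append]
    rfl
  | possible O φ ih | necessary O φ ih =>
    rw [Formula.word, decorate_cons, decorate_append, Sweeper.annotate, List.flatMap_cons,
      O.isTerm_decorate.annotate_append, List.flatMap_append, ih, nil_of_descriptor,
      O.isTerm_decorate.value_binary rfl]
    simp only [Token.obsBit, Val.comb, Token.sem, O.sem_value]
    rfl

theorem clear_value {u : List (Token V Ch D K CV × (P).E)} (hu : (P).IsTerm u) :
    ((P).value u).clear ↔ ∀ x ∈ u, x.2.1.clear := by
  induction hu with
  | leaf hx => simp [Sweeper.value_leaf hx, Val.comb, Val.bot]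
  | unary hx _ ih => simp [Sweeper.value_unary hx, Val.comb, Val.bot, ih]
  | binary hx hu _ ih₁ ih₂ =>
    rw [hu.value_binary hx, List.forall_mem_cons, List.forall_mem_append]
    exact and_congr Iff.rfl (and_congr ih₁ ih₂)

theorem diag_value {u : List (Token V Ch D K CV × (P).E)} (hu : (P).IsTerm u) :
    ((P).value u).diag ↔ ∀ x ∈ u, x.2.1 = x.2.2 := by
  induction hu with
  | leaf hx => simp [Sweeper.value_leaf hx, Val.comb, Val.bot]
  | unary hx _ ih => simp [Sweeper.value_unary hx, Val.comb, Val.bot, ih]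
  | binary hx hu _ ih₁ ih₂ =>
    rw [hu.value_binary hx, List.forall_mem_cons, List.forall_mem_append]
    exact and_congr Iff.rfl (and_congr ih₁ ih₂)

end Values

section Records
variable {V Ch D K CV : Type}

/-- The name of a state in the description of an automaton. -/
def State.name {n : ℕ} (q : State n) : List Bool := (List.ofFn q).flatMap Entry.bits

theorem State.name_injective {n : ℕ} : Function.Injective (State.name (n := n)) := by
  have flatMap_bits_injective : Function.Injective (List.flatMap Entry.bits) := fun l => by
    induction l with
    | nil => rintro (_ | ⟨e, l'⟩) h <;> simp_all [Entry.bits]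
    | cons e l ih =>
      rintro (_ | ⟨e', l'⟩) h
      · simp [Entry.bits] at h
      · simp only [List.flatMap_cons, Entry.bits, List.cons_append, List.nil_append,
          List.cons.injEq] at h
        rw [ih h.2.2, show e = e' by cases e; cases e'; simp_all]
  exact flatMap_bits_injective.comp List.ofFn_injective

/-- Two states as a word of digits. -/
def pairDigits {n : ℕ} (x : State n × State n) : List Digit :=
  List.ofFn fun k => (x.1 k, x.2 k)

/-- The word of a formula, decorated with two states. -/
def Formula.pairWord (φ : Formula V Ch D K CV) (q q' : State φ.size) :
    List (Token V Ch D K CV × Digit) :=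
  φ.word.zip (pairDigits (q, q'))

variable {φ : Formula V Ch D K CV} {q q' : State φ.size}

theorem Formula.pairWord_eq_decorate :
    φ.pairWord q q' = decorate (fun p => (q.entry p, q'.entry p)) φ.word 0 :=
  zip_ofFn _ _ _ fun k => Prod.ext (q.entry_val k) (q'.entry_val k)

theorem Formula.map_snd_pairWord :
    (φ.pairWord q q').map Prod.snd = pairDigits (q, q') :=
  List.map_snd_zip (by simp [pairDigits, Formula.size])

theorem Formula.forall_mem_pairWord {r : Digit → Prop} :
    (∀ x ∈ φ.pairWord q q', r x.2) ↔ ∀ k, r (q k, q' k) := by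
  rw [← List.forall_mem_map (f := Prod.snd) (P := r), φ.map_snd_pairWord,
    pairDigits, List.forall_mem_ofFn_iff]

/-- The observations that satisfy the same top-level descriptors as `m`. -/
def Formula.obsClass (φ : Formula V Ch D K CV) (m : Observation Ch D K CV) :
    Set (Observation Ch D K CV) :=
  {m' | φ.obsSet m = φ.obsSet m'}

theorem Formula.obsClass_inj {m m' : Observation Ch D K CV} :
    φ.obsClass m = φ.obsClass m' ↔ φ.obsSet m = φ.obsSet m' := by
  refine ⟨fun h => ?_, fun h => by simp only [Formula.obsClass, h]⟩
  exact (h ▸ rfl : m ∈ φ.obsClass m').symm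

/-- The transition of a letter, given by an observation, and two states. -/
def Formula.transition (φ : Formula V Ch D K CV)
    (x : ((V → Bool) × Observation Ch D K CV) × (State φ.size × State φ.size)) :
    φ.automaton.Q × φ.Letter × φ.automaton.Q :=
  (x.2.1, (x.1.1, φ.obsSet x.1.2), x.2.2)

/-- The transitions, each given by one representative observation. -/
def Formula.steps (φ : Formula V Ch D K CV) :
    Set (((V → Bool) × Observation Ch D K CV) × (State φ.size × State φ.size)) :=
  {x | φ.transition x ∈ φ.automaton.transitions ∧ x.1.2 ∈ representatives φ.obsClass}

theorem Formula.bijOn_transition : φ.steps.BijOn φ.transition φ.automaton.transitions := by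
  refine ⟨fun x hx => hx.1, ?_, ?_⟩
  · intro x hx y hy h
    have obsSet_eq : φ.obsSet x.1.2 = φ.obsSet y.1.2 := congrArg (fun t => t.2.1.2) h
    exact Prod.ext
      (Prod.ext (congrArg (fun t => t.2.1.1) h)
        (eq_of_mem_representatives hx.2 hy.2 (Formula.obsClass_inj.2 obsSet_eq)))
      (Prod.ext (congrArg (fun t => t.1) h) (congrArg (fun t => t.2.2) h))
  · rintro ⟨q, ⟨σ, _⟩, q'⟩ h
    obtain ⟨m, rfl, -⟩ := id h
    obtain ⟨m', hm', heq⟩ := exists_mem_representatives φ.obsClass m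
    have transition_eq : φ.transition ((σ, m'), q, q') = (q, (σ, φ.obsSet m), q') := by
      rw [Formula.transition, Formula.obsClass_inj.1 heq]
    exact ⟨((σ, m'), q, q'), ⟨transition_eq ▸ h, hm'⟩, transition_eq⟩

variable [Finite V] [Finite Ch] [Finite D] [Finite K] [Finite CV]
  {zero : Digit} {succ : Digit → Option Digit}
  {next : Option ((V → Bool) × Observation Ch D K CV) →
    Option (Option ((V → Bool) × Observation Ch D K CV))}

local notation "P" => writer zero succ next

theorem Formula.isTerm_pairWord : (P).IsTerm (φ.pairWord q q') :=
  φ.pairWord_eq_decorate ▸ φ.isTerm_decorate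

theorem Formula.clear_pairWord : ((P).value (φ.pairWord q q')).clear ↔ q.Accepting := by
  rw [clear_value φ.isTerm_pairWord, State.accepting_iff]
  exact Formula.forall_mem_pairWord (r := fun e => e.1.clear)

theorem Formula.diag_pairWord : ((P).value (φ.pairWord q q')).diag ↔ q = q' := by
  rw [diag_value φ.isTerm_pairWord, funext_iff]
  exact Formula.forall_mem_pairWord (r := fun e => e.1 = e.2)

theorem Formula.admits_pairWord {a : (V → Bool) × Observation Ch D K CV} :
    ((P).value (φ.pairWord q q')).Admits (some a) ↔ (a, q, q') ∈ φ.steps := by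
  have cls : ((P).value (φ.pairWord q q')).cls = φ.obsClass := by
    funext m
    ext m'
    rw [φ.pairWord_eq_decorate, Formula.mem_cls_value, Formula.obsClass, Set.mem_ofPred_eq]
  rw [Val.Admits, cls, propext φ.clear_pairWord, φ.pairWord_eq_decorate, φ.ok_value,
    ← φ.mem_δ_automaton]
  rfl

theorem Formula.flatMap_bits_pairWord (h : Digit → Entry) :
    ((P).annotate (φ.pairWord q q')).flatMap (fun x => (h x.1.2).bits.map .bit) =
      (State.name fun k => h (q k, q' k)).map (OutSym.bit (V := V)) := by
  have entries : ((P).annotate (φ.pairWord q q')).map (fun x => h x.1.2) =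
      List.ofFn fun k => h (q k, q' k) := by
    calc ((P).annotate (φ.pairWord q q')).map (fun x => h x.1.2)
        = ((((P).annotate (φ.pairWord q q')).map Prod.fst).map Prod.snd).map h := by
          rw [List.map_map, List.map_map]; rfl
      _ = List.ofFn fun k => h (q k, q' k) := by
          rw [Sweeper.map_fst_annotate, φ.map_snd_pairWord, pairDigits, List.map_ofFn]; rfl
  rw [State.name, List.map_flatMap, ← entries, List.flatMap_map]

open Classical in
theorem output_writer (c : Control V Ch D K CV) (u : List (Token V Ch D K CV × Digit)) :
    (P).output c u = if ((P).value u).Admits c.1 then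
      ((P).value u).header c ++ ((P).annotate u).flatMap (cellOutput · c) else [] := by
  by_cases h : ((P).value u).Admits c.1 <;> simp [Sweeper.output, h]

open Classical in
theorem Formula.flatMap_output_none :
    ([0, 1, 2] : List (Fin 3)).flatMap (fun j => (P).output (none, j) (φ.pairWord q q')) =
      if q = q' then stateRecord φ.automaton State.name q else [] := by
  have init : ((P).value (φ.pairWord q q')).root.1.due = decide (q ∈ φ.automaton.init) := by
    rw [Bool.eq_iff_iff, decide_eq_true_iff, φ.pairWord_eq_decorate, φ.root_value]
    rfl
  have accepting : ((P).value (φ.pairWord q q')).clear ↔ q ∈ φ.automaton.F := φ.clear_pairWord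
  have diag : ((P).value (φ.pairWord q q')).Admits none ↔ q = q' := φ.diag_pairWord
  simp only [output_writer, ← diag]
  split_ifs
  · have name := φ.flatMap_bits_pairWord (zero := zero) (succ := succ) (next := next)
      (q := q) (q' := q') Prod.fst
    simp only [Val.header, cellOutput, stateRecord, name, init, accepting, List.flatMap_cons,
      List.flatMap_nil, List.append_nil, List.cons_append, List.nil_append, List.cons.injEq,
      OutSym.bit.injEq, decide_eq_decide, List.append_right_eq_self, List.append_eq_nil_iff,
      List.flatMap_eq_nil_iff, implies_true, and_self, and_true, true_and]
    exact ⟨Iff.rfl, Iff.rfl⟩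
  · rfl

open Classical in
theorem Formula.flatMap_output_some (a : (V → Bool) × Observation Ch D K CV) :
    ([0, 1, 2] : List (Fin 3)).flatMap (fun j => (P).output (some a, j) (φ.pairWord q q')) =
      if (a, q, q') ∈ φ.steps then
        transRecord φ.automaton State.name (φ.transition (a, q, q')) else [] := by
  simp only [output_writer, ← φ.admits_pairWord (zero := zero) (succ := succ) (next := next)]
  split_ifs
  · have name := φ.flatMap_bits_pairWord (zero := zero) (succ := succ) (next := next)
      (q := q) (q' := q')
    have letter := φ.flatMap_obsBit (zero := zero) (succ := succ) (next := next)
      (g := fun p => (q.entry p, q'.entry p)) (p := 0) a.2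
    rw [← φ.pairWord_eq_decorate] at letter
    have obs : φ.descriptors.attach.map (fun O => .bit (decide (O ∈ φ.obsSet a.2))) =
        φ.descriptors.map fun O => OutSym.bit (V := V) (decide (O.Sat a.2)) :=
      List.attach_map_val (f := fun O : Descriptor Ch D K CV => OutSym.bit (decide (O.Sat a.2)))
    simp only [Val.header, cellOutput, List.flatMap_cons, List.flatMap_nil, List.cons_append,
      List.nil_append, List.append_nil, letter, name Prod.fst, name Prod.snd, transRecord,
      Formula.transition, List.cons.injEq, List.append_cancel_left_eq,
      List.append_cancel_right_eq, true_and]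
    exact obs.symm
  · rfl

end Records

section Description
variable {V Ch D K CV : Type} [Finite V] [Finite Ch] [Finite D] [Finite K] [Finite CV]

theorem exists_enumerates_pairDigits : ∃ (zero : Digit) (succ : Digit → Option Digit), ∀ n : ℕ,
    ∃ ps : List (State n × State n), IsListing ps ∧
      Enumerates (succWord succ zero) (List.replicate n zero) (ps.map pairDigits) := by
  have : Nonempty Digit := ⟨⟨false, true⟩, ⟨false, true⟩⟩
  obtain ⟨succ, zero, l, henum, hl⟩ := exists_enumerates Digit
  refine ⟨zero, succ, fun n => ?_⟩
  obtain ⟨ws, hws, henum⟩ := henum.words hl n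
  refine ⟨_, hws.map
    (Equiv.arrowProdEquivProdArrow (Fin n) (fun _ => Entry) fun _ => Entry).bijective, ?_⟩
  rw [List.map_map]
  exact henum

variable {φ : Formula V Ch D K CV} {zero : Digit} {succ : Digit → Option Digit}
  {next : Option ((V → Bool) × Observation Ch D K CV) →
    Option (Option ((V → Bool) × Observation Ch D K CV))}
  {l : List ((V → Bool) × Observation Ch D K CV)} {ps : List (State φ.size × State φ.size)}

open Classical in
theorem flatMap_output_eq :
    ((((none :: l.map some) ×ˢ ps.map pairDigits) ×ˢ ([0, 1, 2] : List (Fin 3))).flatMap fun c =>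
        (writer zero succ next).output (c.1.1, c.2) (φ.word.zip c.1.2)) =
      (ps.flatMap fun x =>
        if x ∈ Set.diagonal (State φ.size) then stateRecord φ.automaton State.name x.1 else []) ++
      (l ×ˢ ps).flatMap fun x =>
        if x ∈ φ.steps then transRecord φ.automaton State.name (φ.transition x) else [] := by
  simp only [flatMap_product, List.flatMap_cons, List.flatMap_map]
  refine congrArg₂ (· ++ ·) (List.flatMap_congr fun x _ => ?_)
    (List.flatMap_congr fun a _ => List.flatMap_congr fun x _ => ?_)
  · exact φ.flatMap_output_none
  · exact φ.flatMap_output_some a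

open Classical in
theorem isDescription_output (hl : IsListing l) (hps : IsListing ps) :
    IsDescription φ.automaton
      ((((none :: l.map some) ×ˢ ps.map pairDigits) ×ˢ ([0, 1, 2] : List (Fin 3))).flatMap fun c =>
        (writer zero succ next).output (c.1.1, c.2) (φ.word.zip c.1.2)) := by
  have diagonal : (Set.diagonal (State φ.size)).BijOn Prod.fst Set.univ :=
    ⟨fun _ _ => trivial, fun x hx y hy h => Prod.ext h (hx.symm.trans (h.trans hy)),
      fun q _ => ⟨(q, q), rfl, rfl⟩⟩
  obtain ⟨qs, nodup_qs, mem_qs, states⟩ :=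
    hps.exists_flatMap_ite diagonal (stateRecord φ.automaton State.name)
  obtain ⟨ts, nodup_ts, mem_ts, transitions⟩ := (hl.product hps).exists_flatMap_ite
    φ.bijOn_transition (transRecord φ.automaton State.name)
  exact ⟨State.name, qs, ts, State.name_injective, nodup_qs, fun q => (mem_qs q).2 trivial,
    nodup_ts, mem_ts, flatMap_output_eq.trans (congrArg₂ (· ++ ·) states transitions)⟩

theorem exists_machine [Finite (Token V Ch D K CV)] :
    ∃ M : Machine (Token V Ch D K CV) (OutSym V),
    ∀ φ : Formula V Ch D K CV, (∃ out, M.HaltsWith φ.word out ∧ IsDescription φ.automaton out) ∧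
      M.UsesSpace φ.word (2 * φ.size + 2) := by
  obtain ⟨zero, succ, words⟩ := exists_enumerates_pairDigits
  obtain ⟨next, l, letters, hl⟩ := exists_enumerates_option ((V → Bool) × Observation Ch D K CV)
  refine ⟨(writer zero succ next).machine, fun φ => ?_⟩
  obtain ⟨ps, hps, digits⟩ := words φ.size
  have parts : Enumerates (writer zero succ next).nextJ (0 : Fin 3) [0, 1, 2] :=
    .step rfl (.step rfl (.last rfl))
  have length_digits : ∀ es ∈ ps.map pairDigits, es.length = φ.word.length := by
    rintro _ h
    obtain ⟨x, -, rfl⟩ := List.mem_map.1 h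
    exact List.length_ofFn
  obtain ⟨halts, space⟩ := Sweeper.machine_spec letters parts digits length_digits
  exact ⟨⟨_, halts, isDescription_output hl hps⟩, space⟩

end Description

end LTOL

theorem corollary2 :
    ∃ C : ℕ, ∀ (V Ch D K CV : Type) [Fintype V] [Fintype Ch] [Fintype D] [Fintype K] [Fintype CV],
      ∃ M : LTOL.Machine (LTOL.Token V Ch D K CV) (LTOL.OutSym V),
        ∀ φ : LTOL.Formula V Ch D K CV, ∃ N : LTOL.NBW φ.Letter,
          (⋃ w ∈ N.lang, φ.wordLang w) = {ρ | φ.SatAt ρ 0} ∧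
          N.numStates ≤ 2 ^ (C * φ.size) ∧
          N.numTransitions ≤
            N.numStates ^ 2 * Nat.card (V → Bool) * Nat.card (Set φ.Obs) ∧
          N.numTransitions ≤ 2 ^ Fintype.card V * 2 ^ (C * φ.size) ∧
          N.size ≤ 2 ^ Fintype.card V * 2 ^ (C * φ.size) ∧
          (∃ out, M.HaltsWith φ.word out ∧ LTOL.IsDescription N out) ∧
          M.UsesSpace φ.word (C * φ.size) := by
  refine ⟨7, fun V Ch D K CV _ _ _ _ _ => ?_⟩
  obtain ⟨M, hM⟩ := LTOL.exists_machine (V := V) (Ch := Ch) (D := D) (K := K) (CV := CV)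
  refine ⟨M, fun φ => ⟨φ.automaton, φ.iUnion_wordLang_automaton, ?_, φ.automaton.numTransitions_le,
    ?_, φ.size_automaton_le, (hM φ).1, ?_⟩⟩
  · exact φ.numStates_automaton.le.trans (Nat.pow_le_pow_right two_pos (by omega))
  · refine φ.numTransitions_automaton_le.trans (Nat.mul_le_mul_left _ ?_)
    exact Nat.pow_le_pow_right two_pos (by omega)
  · exact (hM φ).2.mono (by have := φ.size_pos; omega)
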